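/- Let $\check\otimes$ denote the spatial (minimal) tensor product of unital $C^*$-algebras. A unital $C^*$-algebra $\mathcal A$ has spatially continuous multiplication if the linear map $a\otimes b\mapsto ab$ on the algebraic tensor product of $\mathcal A$ with itself is continuous for the spatial norm; $m:\mathcal A\check\otimes\mathcal A\to\mathcal A$ then denotes its continuous extension. Let $\mathfrak F:\mathcal A\check\otimes\mathcal A\to\mathcal A\check\otimes\mathcal A$ be the flip, $\mathfrak F(a\otimes b)=b\otimes a$, and let $\mathfrak M:\mathcal A\check\otimes\mathcal A\to\mathcal A\check\otimes\mathcal A\check\otimes\mathcal A$ be the $*$-homomorphism with $\mathfrak M(a\otimes b)=a\otimes 1\otimes b$. An algebraic compact quantum metric space is a pair $(\mathcal A,\rho)$ of a unital $C^*$-algebra $\mathcal A$ with spatially continuous multiplication and an element $\rho\in\mathcal A\check\otimes\mathcal A$ such that (i) $\rho\ge 0$; (ii) $m(\rho)=0$; (iii) for every $\nu\in\mathcal A\check\otimes\mathcal A$ with $\nu\ge 0$, $m(\nu)=1$ and $\mathfrak F(\nu)=\nu$, the element $\rho+\nu$ is invertible in $\mathcal A\check\otimes\mathcal A$; (iv)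 $\mathfrak F(\rho)=\rho$; (v) $\mathfrak M(\rho)\le \rho\otimes 1+1\otimes\rho$. Theorem. Let $(\mathcal A_1,\rho_1)$ and $(\mathcal A_2,\rho_2)$ be algebraic compact quantum metric spaces such that $\mathcal A_1$ is commutative. Then $(\mathcal A_1\check\otimes\mathcal A_2,\rho)$ is an algebraic compact quantum metric space, where $$\rho=\rho_1\otimes 1_{\mathcal A_2\check\otimes\mathcal A_2}+1_{\mathcal A_1\check\otimes\mathcal A_1}\otimes\rho_2\in(\mathcal A_1\check\otimes\mathcal A_1)\check\otimes(\mathcal A_2\check\otimes\mathcal A_2)\cong(\mathcal A_1\check\otimes\mathcal A_2)\check\otimes(\mathcal A_1\check\otimes\mathcal A_2),$$ the isomorphism being $(a\otimes a')\otimes(b\otimes b')\mapsto(a\otimes b)\otimes(a'\otimes b')$. -/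

import Mathlib

open scoped TensorProduct

universe u

set_option linter.unusedSectionVars false

noncomputable section

/-! ## The Hilbert space tensor product and tensor products of operators -/

section HilbertTensor

variable (H K : Type*) [NormedAddCommGroup H] [InnerProductSpace ℂ H] [CompleteSpace H]
  [NormedAddCommGroup K] [InnerProductSpace ℂ K] [CompleteSpace K]

/-- The Hilbert space tensor product of `H` and `K`: the completion of the algebraic tensor product
for the inner product `⟪x ⊗ y, x' ⊗ y'⟫ = ⟪x, x'⟫ ⟪y, y'⟫`. -/
def HilbertTensor : Type _ := UniformSpace.Completion (H ⊗[ℂ] K)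

instance : NormedAddCommGroup (HilbertTensor H K) :=
  inferInstanceAs (NormedAddCommGroup (UniformSpace.Completion (H ⊗[ℂ] K)))

instance : InnerProductSpace ℂ (HilbertTensor H K) :=
  inferInstanceAs (InnerProductSpace ℂ (UniformSpace.Completion (H ⊗[ℂ] K)))

instance : CompleteSpace (HilbertTensor H K) :=
  inferInstanceAs (CompleteSpace (UniformSpace.Completion (H ⊗[ℂ] K)))

/-- The canonical isometric embedding of the algebraic tensor product. -/
def HilbertTensor.of : H ⊗[ℂ] K →ₗᵢ[ℂ] HilbertTensor H K :=
  (UniformSpace.Completion.toComplₗᵢ : H ⊗[ℂ] K →ₗᵢ[ℂ] UniformSpace.Completion (H ⊗[ℂ] K))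

variable {H K}

@[elab_as_elim]
theorem HilbertTensor.induction_on {p : HilbertTensor H K → Prop} (x : HilbertTensor H K)
    (hp : IsClosed {x | p x}) (ih : ∀ x, p (HilbertTensor.of H K x)) : p x :=
  UniformSpace.Completion.induction_on x hp ih

theorem inner_rTensor_adjoint (T : H →L[ℂ] H) (x y : H ⊗[ℂ] K) :
    inner ℂ ((T : H →ₗ[ℂ] H).rTensor K x) y =
      inner ℂ x (((star T : H →L[ℂ] H) : H →ₗ[ℂ] H).rTensor K y) := by
  induction x with
  | zero => simp
  | add x x' hx hx' => simp [inner_add_left, hx, hx']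
  | tmul a b =>
    induction y with
    | zero => simp
    | add y y' hy hy' => simp only [map_add, inner_add_right, hy, hy']
    | tmul c d =>
      simp [ContinuousLinearMap.star_eq_adjoint, ContinuousLinearMap.adjoint_inner_right]

theorem norm_rTensor_le (T : H →L[ℂ] H) (x : H ⊗[ℂ] K) :
    ‖(T : H →ₗ[ℂ] H).rTensor K x‖ ≤ ‖T‖ * ‖x‖ := by
  have h0 : 0 ≤ algebraMap ℝ (H →L[ℂ] H) (‖T‖ ^ 2) - star T * T :=
    sub_nonneg.2 CStarAlgebra.star_mul_le_algebraMap_norm_sq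
  obtain ⟨R, hR⟩ := CStarAlgebra.nonneg_iff_eq_star_mul_self.1 h0
  have key (S : H →L[ℂ] H) : ((‖(S : H →ₗ[ℂ] H).rTensor K x‖ : ℂ) ^ 2) =
      inner ℂ x (((star S * S : H →L[ℂ] H) : H →ₗ[ℂ] H).rTensor K x) := by
    have := inner_self_eq_norm_sq_to_K (𝕜 := ℂ) ((S : H →ₗ[ℂ] H).rTensor K x)
    rw [inner_rTensor_adjoint] at this
    rw [← LinearMap.comp_apply, ← LinearMap.rTensor_comp] at this
    rw [ContinuousLinearMap.toLinearMap_mul, Module.End.mul_eq_comp]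
    simpa using this.symm
  have hsum : (algebraMap ℝ (H →L[ℂ] H) (‖T‖ ^ 2) : H →L[ℂ] H) = star T * T + star R * R := by
    rw [← hR]; abel
  have h1 : inner ℂ x (((algebraMap ℝ (H →L[ℂ] H) (‖T‖ ^ 2) : H →L[ℂ] H) :
      H →ₗ[ℂ] H).rTensor K x) = (‖T‖ : ℂ) ^ 2 * (‖x‖ : ℂ) ^ 2 := by
    have : ((algebraMap ℝ (H →L[ℂ] H) (‖T‖ ^ 2) : H →L[ℂ] H) : H →ₗ[ℂ] H) =
        ((‖T‖ : ℂ) ^ 2) • LinearMap.id := by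
      ext y
      simp [Algebra.algebraMap_eq_smul_one, ← Complex.coe_smul]
    rw [this, LinearMap.rTensor_smul, LinearMap.rTensor_id]
    simp [inner_smul_right, inner_self_eq_norm_sq_to_K]
  rw [hsum, ContinuousLinearMap.toLinearMap_add, LinearMap.rTensor_add, LinearMap.add_apply,
    inner_add_right, ← key, ← key] at h1
  have h2 : ‖(T : H →ₗ[ℂ] H).rTensor K x‖ ^ 2 + ‖(R : H →ₗ[ℂ] H).rTensor K x‖ ^ 2 =
      (‖T‖ * ‖x‖) ^ 2 := by
    rw [mul_pow]; exact_mod_cast h1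
  have h3 : ‖(T : H →ₗ[ℂ] H).rTensor K x‖ ^ 2 ≤ (‖T‖ * ‖x‖) ^ 2 := by
    nlinarith [sq_nonneg ‖(R : H →ₗ[ℂ] H).rTensor K x‖]
  exact le_of_sq_le_sq h3 (by positivity)

theorem norm_lTensor_le (S : K →L[ℂ] K) (x : H ⊗[ℂ] K) :
    ‖(S : K →ₗ[ℂ] K).lTensor H x‖ ≤ ‖S‖ * ‖x‖ := by
  have h := norm_rTensor_le S (TensorProduct.comm ℂ H K x)
  rw [TensorProduct.norm_comm] at h
  rw [← TensorProduct.norm_comm]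
  convert h using 2
  rw [← LinearMap.comm_comp_lTensor_comp_comm_eq]
  simp

/-- The bounded operator `T ⊗ S` on the algebraic tensor product. -/
def algTensorOp (T : H →L[ℂ] H) (S : K →L[ℂ] K) : H ⊗[ℂ] K →L[ℂ] H ⊗[ℂ] K :=
  (TensorProduct.map (T : H →ₗ[ℂ] H) (S : K →ₗ[ℂ] K)).mkContinuous (‖T‖ * ‖S‖) (by
    intro x
    rw [← LinearMap.rTensor_comp_lTensor, LinearMap.comp_apply, mul_assoc]
    exact (norm_rTensor_le T _).trans
      (mul_le_mul_of_nonneg_left (norm_lTensor_le S x) (norm_nonneg T)))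

/-- The bounded operator `T ⊗ S` on the Hilbert space tensor product. -/
def tensorOp (T : H →L[ℂ] H) (S : K →L[ℂ] K) : HilbertTensor H K →L[ℂ] HilbertTensor H K :=
  ((algTensorOp T S).completion :
    UniformSpace.Completion (H ⊗[ℂ] K) →L[ℂ] UniformSpace.Completion (H ⊗[ℂ] K))

theorem tensorOp_of (T : H →L[ℂ] H) (S : K →L[ℂ] K) (x : H ⊗[ℂ] K) :
    tensorOp T S (HilbertTensor.of H K x) =
      HilbertTensor.of H K (TensorProduct.map (T : H →ₗ[ℂ] H) (S : K →ₗ[ℂ] K) x) :=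
  (algTensorOp T S).completion_apply_coe x

theorem tensorOp_of_tmul (T : H →L[ℂ] H) (S : K →L[ℂ] K) (a : H) (b : K) :
    tensorOp T S (HilbertTensor.of H K (a ⊗ₜ b)) = HilbertTensor.of H K (T a ⊗ₜ S b) := by
  rw [tensorOp_of]; rfl

theorem tensorOp_ext {E : Type*} [NormedAddCommGroup E] [NormedSpace ℂ E]
    {f g : HilbertTensor H K →L[ℂ] E}
    (h : ∀ (a : H) (b : K), f (HilbertTensor.of H K (a ⊗ₜ b)) =
      g (HilbertTensor.of H K (a ⊗ₜ b))) : f = g := by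
  ext x
  induction x using HilbertTensor.induction_on with
  | hp => exact isClosed_eq f.continuous g.continuous
  | ih x =>
    induction x with
    | zero => simp only [map_zero]
    | add x y hx hy => simp only [map_add, hx, hy]
    | tmul a b => exact h a b

theorem norm_tensorOp_le (T : H →L[ℂ] H) (S : K →L[ℂ] K) : ‖tensorOp T S‖ ≤ ‖T‖ * ‖S‖ := by
  refine ContinuousLinearMap.opNorm_le_bound _ (by positivity) fun x => ?_
  induction x using HilbertTensor.induction_on with
  | hp => exact isClosed_le (by fun_prop) (by fun_prop)
  | ih x =>
    rw [tensorOp_of, LinearIsometry.norm_map, LinearIsometry.norm_map,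
      ← LinearMap.rTensor_comp_lTensor, LinearMap.comp_apply, mul_assoc]
    exact (norm_rTensor_le T _).trans
      (mul_le_mul_of_nonneg_left (norm_lTensor_le S x) (norm_nonneg T))

theorem tensorOp_mul (T T' : H →L[ℂ] H) (S S' : K →L[ℂ] K) :
    tensorOp (T * T') (S * S') = tensorOp T S * tensorOp T' S' :=
  tensorOp_ext fun a b => by
    simp only [mul_apply_eq_comp, tensorOp_of_tmul]

theorem tensorOp_one : tensorOp (1 : H →L[ℂ] H) (1 : K →L[ℂ] K) = 1 :=
  tensorOp_ext fun a b => by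
    simp only [one_apply_eq_self, tensorOp_of_tmul]

theorem tensorOp_star (T : H →L[ℂ] H) (S : K →L[ℂ] K) :
    tensorOp (star T) (star S) = star (tensorOp T S) := by
  rw [ContinuousLinearMap.star_eq_adjoint (tensorOp T S), ContinuousLinearMap.eq_adjoint_iff]
  intro x y
  induction x using HilbertTensor.induction_on with
  | hp => exact isClosed_eq (by fun_prop) (by fun_prop)
  | ih x =>
  induction y using HilbertTensor.induction_on with
  | hp => exact isClosed_eq (by fun_prop) (by fun_prop)
  | ih y =>
    rw [tensorOp_of, tensorOp_of, LinearIsometry.inner_map_map, LinearIsometry.inner_map_map]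
    induction x with
    | zero => simp
    | add x x' hx hx' => simp only [map_add, inner_add_left, hx, hx']
    | tmul a b =>
      induction y with
      | zero => simp
      | add y y' hy hy' => simp only [map_add, inner_add_right, hy, hy']
      | tmul c d =>
        simp [ContinuousLinearMap.star_eq_adjoint, ContinuousLinearMap.adjoint_inner_left]

variable (H K) in
/-- The flip `x ⊗ y ↦ y ⊗ x` on Hilbert space tensor products. -/
def flipOp : HilbertTensor H K →L[ℂ] HilbertTensor K H :=
  (((TensorProduct.commIsometry ℂ H K).toContinuousLinearEquiv :
    H ⊗[ℂ] K →L[ℂ] K ⊗[ℂ] H).completion :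
    UniformSpace.Completion (H ⊗[ℂ] K) →L[ℂ] UniformSpace.Completion (K ⊗[ℂ] H))

theorem flipOp_of (x : H ⊗[ℂ] K) :
    flipOp H K (HilbertTensor.of H K x) = HilbertTensor.of K H (TensorProduct.comm ℂ H K x) :=
  ContinuousLinearMap.completion_apply_coe _ x

theorem norm_flipOp (x : HilbertTensor H K) : ‖flipOp H K x‖ = ‖x‖ := by
  induction x using HilbertTensor.induction_on with
  | hp => exact isClosed_eq (by fun_prop) (by fun_prop)
  | ih x =>
    rw [flipOp_of, LinearIsometry.norm_map, LinearIsometry.norm_map, TensorProduct.norm_comm]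

theorem flipOp_flipOp (x : HilbertTensor H K) : flipOp K H (flipOp H K x) = x := by
  induction x using HilbertTensor.induction_on with
  | hp => exact isClosed_eq (by fun_prop) (by fun_prop)
  | ih x => rw [flipOp_of, flipOp_of]; simp

theorem tensorOp_comp_flipOp (T : H →L[ℂ] H) (S : K →L[ℂ] K) :
    tensorOp S T ∘L flipOp H K = flipOp H K ∘L tensorOp T S :=
  tensorOp_ext fun a b => by
    simp only [ContinuousLinearMap.comp_apply, flipOp_of, TensorProduct.comm_tmul,
      tensorOp_of_tmul]

variable (H K) in
/-- `(T, S) ↦ T ⊗ S` as a bilinear map. -/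
def tensorOpBilin : (H →L[ℂ] H) →ₗ[ℂ] (K →L[ℂ] K) →ₗ[ℂ]
    (HilbertTensor H K →L[ℂ] HilbertTensor H K) :=
  LinearMap.mk₂ ℂ tensorOp
    (fun T T' S => tensorOp_ext fun a b => by
      simp only [add_apply, tensorOp_of_tmul, TensorProduct.add_tmul, map_add])
    (fun c T S => tensorOp_ext fun a b => by
      simp only [smul_apply, tensorOp_of_tmul, ← TensorProduct.smul_tmul',
        map_smul])
    (fun T S S' => tensorOp_ext fun a b => by
      simp only [add_apply, tensorOp_of_tmul, TensorProduct.tmul_add, map_add])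
    (fun c T S => tensorOp_ext fun a b => by
      simp only [smul_apply, tensorOp_of_tmul, TensorProduct.tmul_smul,
        map_smul])

end HilbertTensor

/-! ## The spatial norm on the algebraic tensor product -/

/-- A (unital) representation of a unital C⋆-algebra `A` on a Hilbert space. By the
Gelfand-Naimark theorem, Hilbert spaces in the universe of `A` suffice for a faithful one. -/
structure CStarRep (A : Type u) [CStarAlgebra A] where
  /-- the Hilbert space -/
  H : Type u
  [normed : NormedAddCommGroup H]
  [inner : InnerProductSpace ℂ H]
  [complete : CompleteSpace H]
  /-- the action -/
  π : A →⋆ₐ[ℂ] (H →L[ℂ] H)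

attribute [instance] CStarRep.normed CStarRep.inner CStarRep.complete

section SpatialNorm

variable {A B : Type u} [CStarAlgebra A] [CStarAlgebra B]

/-- The representation `π ⊗ σ` of the algebraic tensor product, as an algebra homomorphism. -/
def tensorRepAlg (π : CStarRep A) (σ : CStarRep B) :
    A ⊗[ℂ] B →ₐ[ℂ] (HilbertTensor π.H σ.H →L[ℂ] HilbertTensor π.H σ.H) :=
  Algebra.TensorProduct.algHomOfLinearMapTensorProduct
    (TensorProduct.lift ((tensorOpBilin π.H σ.H).compl₁₂
      π.π.toAlgHom.toLinearMap σ.π.toAlgHom.toLinearMap))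
    (fun a a' b b' => by simp [tensorOpBilin, tensorOp_mul])
    (by simp [tensorOpBilin, tensorOp_one])

theorem tensorRepAlg_tmul (π : CStarRep A) (σ : CStarRep B) (a : A) (b : B) :
    tensorRepAlg π σ (a ⊗ₜ[ℂ] b) = tensorOp (π.π a) (σ.π b) := by
  simp [tensorRepAlg, tensorOpBilin]

/-- The representation `π ⊗ σ` of the algebraic tensor product `A ⊗ B` on the Hilbert space tensor
product, `(π ⊗ σ) (a ⊗ b) = π a ⊗ σ b`. -/
def tensorRep (π : CStarRep A) (σ : CStarRep B) :
    A ⊗[ℂ] B →⋆ₐ[ℂ] (HilbertTensor π.H σ.H →L[ℂ] HilbertTensor π.H σ.H) where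
  __ := tensorRepAlg π σ
  map_star' x := by
    change tensorRepAlg π σ (star x) = star (tensorRepAlg π σ x)
    induction x with
    | zero => rw [star_zero, map_zero, star_zero]
    | add x y hx hy => rw [star_add, map_add, map_add, star_add, hx, hy]
    | tmul a b =>
      rw [TensorProduct.star_tmul, tensorRepAlg_tmul, tensorRepAlg_tmul, map_star, map_star,
        tensorOp_star]

theorem tensorRep_tmul (π : CStarRep A) (σ : CStarRep B) (a : A) (b : B) :
    tensorRep π σ (a ⊗ₜ[ℂ] b) = tensorOp (π.π a) (σ.π b) :=
  tensorRepAlg_tmul π σ a b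

/-- The spatial (minimal) norm on the algebraic tensor product: the supremum of
`‖(π ⊗ σ) x‖` over all representations `π` of `A` and `σ` of `B`. -/
def spatialNorm (x : A ⊗[ℂ] B) : ℝ :=
  ⨆ p : CStarRep A × CStarRep B, ‖tensorRep p.1 p.2 x‖

theorem bddAbove_spatialNorm (x : A ⊗[ℂ] B) :
    BddAbove (Set.range fun p : CStarRep A × CStarRep B => ‖tensorRep p.1 p.2 x‖) := by
  suffices h : ∃ C : ℝ, ∀ p : CStarRep A × CStarRep B, ‖tensorRep p.1 p.2 x‖ ≤ C by
    obtain ⟨C, hC⟩ := h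
    exact ⟨C, by rintro _ ⟨p, rfl⟩; exact hC p⟩
  induction x with
  | zero => exact ⟨0, fun p => by rw [map_zero, norm_zero]⟩
  | add x y hx hy =>
    obtain ⟨C, hC⟩ := hx
    obtain ⟨D, hD⟩ := hy
    exact ⟨C + D, fun p => by
      rw [map_add]; exact (norm_add_le _ _).trans (add_le_add (hC p) (hD p))⟩
  | tmul a b =>
    refine ⟨‖a‖ * ‖b‖, fun p => ?_⟩
    rw [tensorRep_tmul]
    refine (norm_tensorOp_le _ _).trans (mul_le_mul ?_ ?_ (norm_nonneg _) (norm_nonneg _))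
    · exact NonUnitalStarAlgHom.norm_apply_le p.1.π a
    · exact NonUnitalStarAlgHom.norm_apply_le p.2.π b

theorem norm_tensorRep_le (π : CStarRep A) (σ : CStarRep B) (x : A ⊗[ℂ] B) :
    ‖tensorRep π σ x‖ ≤ spatialNorm x :=
  le_ciSup (bddAbove_spatialNorm x) (π, σ)

instance : Nonempty (CStarRep A) :=
  ⟨{ H := PUnit
     π := { toFun := fun _ => 0
            map_one' := Subsingleton.elim _ _
            map_mul' := fun _ _ => Subsingleton.elim _ _
            map_zero' := rfl
            map_add' := fun _ _ => Subsingleton.elim _ _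
            commutes' := fun _ => Subsingleton.elim _ _
            map_star' := fun _ => Subsingleton.elim _ _ } }⟩

theorem spatialNorm_le {x : A ⊗[ℂ] B} {C : ℝ}
    (h : ∀ (π : CStarRep A) (σ : CStarRep B), ‖tensorRep π σ x‖ ≤ C) : spatialNorm x ≤ C :=
  ciSup_le fun p => h p.1 p.2

theorem spatialNorm_nonneg (x : A ⊗[ℂ] B) : 0 ≤ spatialNorm x :=
  Real.iSup_nonneg fun _ => norm_nonneg _

theorem spatialNorm_star_mul_self (x : A ⊗[ℂ] B) :
    spatialNorm (star x * x) = spatialNorm x * spatialNorm x := by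
  apply le_antisymm
  · refine spatialNorm_le fun π σ => ?_
    rw [map_mul, map_star, CStarRing.norm_star_mul_self]
    exact mul_self_le_mul_self (norm_nonneg _) (norm_tensorRep_le π σ x)
  · have h : spatialNorm x ≤ √(spatialNorm (star x * x)) := by
      refine spatialNorm_le fun π σ => Real.le_sqrt_of_sq_le ?_
      have := norm_tensorRep_le π σ (star x * x)
      rwa [map_mul, map_star, CStarRing.norm_star_mul_self, ← sq] at this
    rcases (spatialNorm_nonneg x).eq_or_lt with h0 | h0
    · rw [← h0, zero_mul]; exact spatialNorm_nonneg _
    · rw [← sq]; exact (Real.le_sqrt' h0).1 h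

theorem spatialNorm_zero : spatialNorm (0 : A ⊗[ℂ] B) = 0 :=
  le_antisymm (spatialNorm_le fun π σ => by rw [map_zero, norm_zero]) (spatialNorm_nonneg _)

theorem spatialNorm_add_le (x y : A ⊗[ℂ] B) :
    spatialNorm (x + y) ≤ spatialNorm x + spatialNorm y :=
  spatialNorm_le fun π σ => by
    rw [map_add]
    exact (norm_add_le _ _).trans (add_le_add (norm_tensorRep_le π σ x) (norm_tensorRep_le π σ y))

theorem spatialNorm_neg (x : A ⊗[ℂ] B) : spatialNorm (-x) = spatialNorm x := by
  unfold spatialNorm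
  simp only [map_neg, norm_neg]

theorem spatialNorm_mul_le (x y : A ⊗[ℂ] B) :
    spatialNorm (x * y) ≤ spatialNorm x * spatialNorm y :=
  spatialNorm_le fun π σ => by
    rw [map_mul]
    exact (norm_mul_le _ _).trans (mul_le_mul (norm_tensorRep_le π σ x) (norm_tensorRep_le π σ y)
      (norm_nonneg _) (spatialNorm_nonneg _))

theorem spatialNorm_smul_le (c : ℂ) (x : A ⊗[ℂ] B) :
    spatialNorm (c • x) ≤ ‖c‖ * spatialNorm x :=
  spatialNorm_le fun π σ => by
    rw [map_smul, norm_smul]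
    exact mul_le_mul_of_nonneg_left (norm_tensorRep_le π σ x) (norm_nonneg c)

theorem spatialNorm_star (x : A ⊗[ℂ] B) : spatialNorm (star x) = spatialNorm x := by
  unfold spatialNorm
  simp only [map_star, norm_star]

end SpatialNorm

/-! ## The spatial tensor product of two unital C⋆-algebras -/

section SpatialTensor

variable (A B : Type u) [CStarAlgebra A] [CStarAlgebra B]

/-- The algebraic tensor product `A ⊗ B`, carrying the spatial norm. -/
def AlgTensor : Type u := A ⊗[ℂ] B

namespace AlgTensor

instance : Ring (AlgTensor A B) := inferInstanceAs (Ring (A ⊗[ℂ] B))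

instance : StarRing (AlgTensor A B) := inferInstanceAs (StarRing (A ⊗[ℂ] B))

instance : Algebra ℂ (AlgTensor A B) := inferInstanceAs (Algebra ℂ (A ⊗[ℂ] B))

instance : StarModule ℂ (AlgTensor A B) := inferInstanceAs (StarModule ℂ (A ⊗[ℂ] B))

/-- The identity map from the algebraic tensor product to its copy with the spatial norm. -/
def of : A ⊗[ℂ] B ≃⋆ₐ[ℂ] AlgTensor A B :=
  StarAlgEquiv.refl (R := ℂ) (A := A ⊗[ℂ] B)

instance : SeminormedAddCommGroup (AlgTensor A B) :=
  AddGroupSeminorm.toSeminormedAddCommGroup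
    { toFun := fun x => spatialNorm ((of A B).symm x)
      map_zero' := spatialNorm_zero
      add_le' := spatialNorm_add_le (A := A) (B := B)
      neg' := spatialNorm_neg (A := A) (B := B) }

theorem norm_of (x : A ⊗[ℂ] B) : ‖of A B x‖ = spatialNorm x := rfl

instance : SeminormedRing (AlgTensor A B) where
  __ := (inferInstance : Ring (AlgTensor A B))
  __ := (inferInstance : SeminormedAddCommGroup (AlgTensor A B))
  norm_mul_le := spatialNorm_mul_le (A := A) (B := B)

instance : NormedAlgebra ℂ (AlgTensor A B) where
  norm_smul_le := spatialNorm_smul_le (A := A) (B := B)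

instance : NormedStarGroup (AlgTensor A B) where
  norm_star_le x := (spatialNorm_star (A := A) (B := B) x).le

theorem norm_star_mul_self (x : AlgTensor A B) : ‖star x * x‖ = ‖x‖ * ‖x‖ :=
  spatialNorm_star_mul_self (A := A) (B := B) x

end AlgTensor

/-- The spatial (minimal) tensor product of the unital C⋆-algebras `A` and `B`: the completion of
the algebraic tensor product for the spatial norm. -/
def SpatialTensor : Type u := UniformSpace.Completion (AlgTensor A B)

namespace SpatialTensor

open UniformSpace

instance : NormedRing (SpatialTensor A B) :=
  inferInstanceAs (NormedRing (Completion (AlgTensor A B)))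

instance : CompleteSpace (SpatialTensor A B) :=
  inferInstanceAs (CompleteSpace (Completion (AlgTensor A B)))

instance : Algebra ℂ (SpatialTensor A B) :=
  inferInstanceAs (Algebra ℂ (Completion (AlgTensor A B)))

instance : NormedAlgebra ℂ (SpatialTensor A B) where
  norm_smul_le := norm_smul_le (α := ℂ) (β := Completion (AlgTensor A B))

/-- The canonical map from the algebraic tensor product to the spatial tensor product, as an
algebra homomorphism. -/
def ofAlg : AlgTensor A B →ₐ[ℂ] SpatialTensor A B where
  toRingHom := (Completion.coeRingHom : AlgTensor A B →+* Completion (AlgTensor A B))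
  commutes' _ := rfl

theorem norm_ofAlg (x : AlgTensor A B) : ‖ofAlg A B x‖ = ‖x‖ := Completion.norm_coe x

theorem isometry_ofAlg : Isometry (ofAlg A B) :=
  AddMonoidHomClass.isometry_of_norm _ (norm_ofAlg A B)

theorem continuous_ofAlg : Continuous (ofAlg A B) := (isometry_ofAlg A B).continuous

theorem denseRange_ofAlg : DenseRange (ofAlg A B) := Completion.denseRange_coe

variable {A B} in
@[elab_as_elim]
theorem induction_on {p : SpatialTensor A B → Prop} (x : SpatialTensor A B)
    (hp : IsClosed {x | p x}) (ih : ∀ x, p (ofAlg A B x)) : p x :=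
  Completion.induction_on x hp ih

instance : Star (SpatialTensor A B) :=
  ⟨(Completion.map star : Completion (AlgTensor A B) → Completion (AlgTensor A B))⟩

theorem star_ofAlg (x : AlgTensor A B) : star (ofAlg A B x) = ofAlg A B (star x) :=
  Completion.map_coe (star_isometry (E := AlgTensor A B)).uniformContinuous x

theorem continuous_star' : Continuous (star : SpatialTensor A B → SpatialTensor A B) :=
  Completion.continuous_map (f := (star : AlgTensor A B → AlgTensor A B))

instance : StarRing (SpatialTensor A B) where
  star_involutive x := by
    induction x using induction_on with
    | hp =>
      exact isClosed_eq ((continuous_star' A B).comp (continuous_star' A B)) continuous_id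
    | ih x => rw [star_ofAlg, star_ofAlg, star_star]
  star_mul x y := by
    have hs := continuous_star' A B
    induction x using induction_on with
    | hp => exact isClosed_eq (by fun_prop) (by fun_prop)
    | ih x =>
      induction y using induction_on with
      | hp => exact isClosed_eq (by fun_prop) (by fun_prop)
      | ih y => simp only [← map_mul, star_ofAlg, star_mul]
  star_add x y := by
    have hs := continuous_star' A B
    induction x using induction_on with
    | hp => exact isClosed_eq (by fun_prop) (by fun_prop)
    | ih x =>
      induction y using induction_on with
      | hp => exact isClosed_eq (by fun_prop) (by fun_prop)
      | ih y => simp only [← map_add, star_ofAlg, star_add]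

instance : CStarRing (SpatialTensor A B) where
  norm_mul_self_le x := by
    have hs := continuous_star' A B
    induction x using induction_on with
    | hp => exact isClosed_le (by fun_prop) (by fun_prop)
    | ih x =>
      rw [star_ofAlg, ← map_mul, norm_ofAlg, norm_ofAlg, AlgTensor.norm_star_mul_self]

instance : StarModule ℂ (SpatialTensor A B) where
  star_smul c x := by
    have hs := continuous_star' A B
    induction x using induction_on with
    | hp =>
      exact isClosed_eq (hs.comp (continuous_const_smul c)) ((continuous_const_smul (star c)).comp hs)
    | ih x => rw [← map_smul, star_ofAlg, star_ofAlg, star_smul, map_smul]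

instance : CStarAlgebra (SpatialTensor A B) where

/-- The order of the C⋆-algebra: `x ≤ y` iff `y - x` is positive. -/
instance : PartialOrder (SpatialTensor A B) := CStarAlgebra.spectralOrder (SpatialTensor A B)

instance : StarOrderedRing (SpatialTensor A B) :=
  CStarAlgebra.spectralOrderedRing (SpatialTensor A B)

/-- The canonical ⋆-homomorphism from the algebraic to the spatial tensor product. -/
def incl : A ⊗[ℂ] B →⋆ₐ[ℂ] SpatialTensor A B where
  toAlgHom := (ofAlg A B).comp (AlgTensor.of A B : A ⊗[ℂ] B →ₐ[ℂ] AlgTensor A B)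
  map_star' x := (star_ofAlg A B (AlgTensor.of A B x)).symm

theorem norm_incl (x : A ⊗[ℂ] B) : ‖incl A B x‖ = spatialNorm x := norm_ofAlg A B _

theorem denseRange_incl : DenseRange (incl A B) := denseRange_ofAlg A B

variable {A B}

@[elab_as_elim]
theorem induction_incl {p : SpatialTensor A B → Prop} (x : SpatialTensor A B)
    (hp : IsClosed {x | p x}) (ih : ∀ x : A ⊗[ℂ] B, p (incl A B x)) : p x :=
  induction_on x hp ih

section lift

variable {C : Type*} [NormedAddCommGroup C] [NormedSpace ℂ C] [CompleteSpace C]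

/-- The extension to the spatial tensor product of a linear map on the algebraic tensor product
which is continuous for the spatial norm. -/
def extend (f : A ⊗[ℂ] B →ₗ[ℂ] C)
    (hf : Continuous fun x : AlgTensor A B => f ((AlgTensor.of A B).symm x)) :
    SpatialTensor A B →L[ℂ] C :=
  ContinuousLinearMap.extend
    (⟨f ∘ₗ ((AlgTensor.of A B).symm : AlgTensor A B →ₐ[ℂ] A ⊗[ℂ] B).toLinearMap, hf⟩ :
      AlgTensor A B →L[ℂ] C)
    (⟨(ofAlg A B).toLinearMap, continuous_ofAlg A B⟩ : AlgTensor A B →L[ℂ] SpatialTensor A B)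

theorem extend_incl (f : A ⊗[ℂ] B →ₗ[ℂ] C)
    (hf : Continuous fun x : AlgTensor A B => f ((AlgTensor.of A B).symm x)) (x : A ⊗[ℂ] B) :
    extend f hf (incl A B x) = f x :=
  ContinuousLinearMap.extend_eq _ (denseRange_ofAlg A B)
    (isometry_ofAlg A B).isUniformInducing (AlgTensor.of A B x)

end lift

section lift

variable {C : Type*} [CStarAlgebra C]

theorem continuous_of_norm_le (f : A ⊗[ℂ] B →⋆ₐ[ℂ] C) (hf : ∀ x, ‖f x‖ ≤ spatialNorm x) :
    Continuous fun x : AlgTensor A B =>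
      (f : A ⊗[ℂ] B →ₐ[ℂ] C).toLinearMap ((AlgTensor.of A B).symm x) :=
  AddMonoidHomClass.continuous_of_bound
    ((f : A ⊗[ℂ] B →ₐ[ℂ] C).toLinearMap ∘ₗ
      ((AlgTensor.of A B).symm : AlgTensor A B →ₐ[ℂ] A ⊗[ℂ] B).toLinearMap) 1
    (fun x => by rw [one_mul]; exact hf ((AlgTensor.of A B).symm x))

/-- The extension to the spatial tensor product of a ⋆-homomorphism on the algebraic tensor product
which is contractive for the spatial norm. -/
def lift (f : A ⊗[ℂ] B →⋆ₐ[ℂ] C) (hf : ∀ x, ‖f x‖ ≤ spatialNorm x) :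
    SpatialTensor A B →⋆ₐ[ℂ] C where
  toAlgHom := AlgHom.ofLinearMap
    (extend (f : A ⊗[ℂ] B →ₐ[ℂ] C).toLinearMap (continuous_of_norm_le f hf) :
      SpatialTensor A B →ₗ[ℂ] C)
    (by
      rw [← map_one (incl A B)]
      exact (extend_incl _ _ _).trans (map_one f))
    (by
      intro x y
      have hc := (extend (f : A ⊗[ℂ] B →ₐ[ℂ] C).toLinearMap (continuous_of_norm_le f hf)).continuous
      simp only [ContinuousLinearMap.coe_coe]
      induction x using induction_incl with
      | hp =>
        exact isClosed_eq (hc.comp (continuous_mul_const y)) (hc.mul continuous_const)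
      | ih x =>
        induction y using induction_incl with
        | hp =>
          exact isClosed_eq (hc.comp (continuous_const_mul _)) (continuous_const.mul hc)
        | ih y =>
          rw [← map_mul, extend_incl, extend_incl, extend_incl]
          exact map_mul f x y)
  map_star' x := by
    have hc := (extend (f : A ⊗[ℂ] B →ₐ[ℂ] C).toLinearMap (continuous_of_norm_le f hf)).continuous
    change extend (f : A ⊗[ℂ] B →ₐ[ℂ] C).toLinearMap (continuous_of_norm_le f hf) (star x) =
      star (extend (f : A ⊗[ℂ] B →ₐ[ℂ] C).toLinearMap (continuous_of_norm_le f hf) x)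
    induction x using induction_incl with
    | hp => exact isClosed_eq (hc.comp (continuous_star' A B)) (continuous_star.comp hc)
    | ih x =>
      rw [← map_star, extend_incl, extend_incl]
      exact map_star f x

theorem lift_incl (f : A ⊗[ℂ] B →⋆ₐ[ℂ] C) (hf : ∀ x, ‖f x‖ ≤ spatialNorm x) (x : A ⊗[ℂ] B) :
    lift f hf (incl A B x) = f x :=
  extend_incl _ _ x

end lift

section maps

variable {A' B' : Type u} [CStarAlgebra A'] [CStarAlgebra B']

/-- The algebraic tensor product of two ⋆-homomorphisms. -/
def algMap (φ : A →⋆ₐ[ℂ] A') (ψ : B →⋆ₐ[ℂ] B') : A ⊗[ℂ] B →⋆ₐ[ℂ] A' ⊗[ℂ] B' where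
  toAlgHom := Algebra.TensorProduct.map (φ : A →ₐ[ℂ] A') (ψ : B →ₐ[ℂ] B')
  map_star' x := by
    change Algebra.TensorProduct.map (φ : A →ₐ[ℂ] A') (ψ : B →ₐ[ℂ] B') (star x) =
      star (Algebra.TensorProduct.map (φ : A →ₐ[ℂ] A') (ψ : B →ₐ[ℂ] B') x)
    induction x with
    | zero => simp
    | add x y hx hy => simp only [star_add, map_add, hx, hy]
    | tmul a b => simp [map_star]

theorem algMap_tmul (φ : A →⋆ₐ[ℂ] A') (ψ : B →⋆ₐ[ℂ] B') (a : A) (b : B) :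
    algMap φ ψ (a ⊗ₜ b) = φ a ⊗ₜ ψ b := rfl

/-- The pullback of a representation along a ⋆-homomorphism. -/
def _root_.CStarRep.comp (π : CStarRep A') (φ : A →⋆ₐ[ℂ] A') : CStarRep A where
  H := π.H
  π := π.π.comp φ

theorem spatialNorm_algMap_le (φ : A →⋆ₐ[ℂ] A') (ψ : B →⋆ₐ[ℂ] B') (x : A ⊗[ℂ] B) :
    spatialNorm (algMap φ ψ x) ≤ spatialNorm x := by
  refine spatialNorm_le fun π σ => ?_
  have h : tensorRep π σ (algMap φ ψ x) = tensorRep (π.comp φ) (σ.comp ψ) x := by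
    induction x with
    | zero => rw [map_zero, map_zero, map_zero]; rfl
    | add x y hx hy => rw [map_add, map_add, map_add, hx, hy]; rfl
    | tmul a b => rw [algMap_tmul, tensorRep_tmul, tensorRep_tmul]; rfl
  rw [h]
  exact norm_tensorRep_le (π.comp φ) (σ.comp ψ) x

/-- The ⋆-homomorphism `φ ⊗ ψ` between spatial tensor products,
`(φ ⊗ ψ) (a ⊗ b) = φ a ⊗ ψ b`. -/
def map (φ : A →⋆ₐ[ℂ] A') (ψ : B →⋆ₐ[ℂ] B') : SpatialTensor A B →⋆ₐ[ℂ] SpatialTensor A' B' :=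
  lift ((incl A' B').comp (algMap φ ψ))
    (fun x => (norm_incl A' B' _).le.trans (spatialNorm_algMap_le φ ψ x))

theorem map_incl_tmul (φ : A →⋆ₐ[ℂ] A') (ψ : B →⋆ₐ[ℂ] B') (a : A) (b : B) :
    map φ ψ (incl A B (a ⊗ₜ b)) = incl A' B' (φ a ⊗ₜ ψ b) :=
  lift_incl _ _ _

end maps

variable (A B)

/-- The ⋆-homomorphism `a ↦ a ⊗ 1`. -/
def inl : A →⋆ₐ[ℂ] SpatialTensor A B :=
  (incl A B).comp
    { toAlgHom := Algebra.TensorProduct.includeLeft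
      map_star' := fun a => by simp }

/-- The ⋆-homomorphism `b ↦ 1 ⊗ b`. -/
def inr : B →⋆ₐ[ℂ] SpatialTensor A B :=
  (incl A B).comp
    { toAlgHom := Algebra.TensorProduct.includeRight
      map_star' := fun a => by simp }

theorem inl_apply (a : A) : inl A B a = incl A B (a ⊗ₜ 1) := rfl

theorem inr_apply (b : B) : inr A B b = incl A B (1 ⊗ₜ b) := rfl

/-- The flip on the algebraic tensor product. -/
def algFlip : A ⊗[ℂ] A →⋆ₐ[ℂ] A ⊗[ℂ] A where
  toAlgHom := (Algebra.TensorProduct.comm ℂ A A : A ⊗[ℂ] A →ₐ[ℂ] A ⊗[ℂ] A)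
  map_star' x := by
    change Algebra.TensorProduct.comm ℂ A A (star x) = star (Algebra.TensorProduct.comm ℂ A A x)
    induction x with
    | zero => simp
    | add x y hx hy => simp only [star_add, map_add, hx, hy]
    | tmul a b => simp

theorem algFlip_tmul (a b : A) : algFlip A (a ⊗ₜ b) = b ⊗ₜ a := rfl

theorem norm_tensorRep_algFlip_le (π σ : CStarRep A) (x : A ⊗[ℂ] A) :
    ‖tensorRep π σ (algFlip A x)‖ ≤ ‖tensorRep σ π x‖ := by
  have key : tensorRep π σ (algFlip A x) ∘L flipOp σ.H π.H =
      flipOp σ.H π.H ∘L tensorRep σ π x := by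
    induction x with
    | zero => rw [map_zero, map_zero, map_zero, ContinuousLinearMap.zero_comp,
        ContinuousLinearMap.comp_zero]
    | add x y hx hy => rw [map_add, map_add, map_add, ContinuousLinearMap.add_comp,
        ContinuousLinearMap.comp_add, hx, hy]
    | tmul a b => rw [algFlip_tmul, tensorRep_tmul, tensorRep_tmul, tensorOp_comp_flipOp]
  refine ContinuousLinearMap.opNorm_le_bound _ (norm_nonneg _) fun y => ?_
  have h := congrArg (fun f => f (flipOp π.H σ.H y)) key
  simp only [ContinuousLinearMap.comp_apply, flipOp_flipOp] at h
  rw [h, norm_flipOp, ← norm_flipOp y]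
  exact ContinuousLinearMap.le_opNorm _ _

/-- The flip of the spatial tensor product, `a ⊗ b ↦ b ⊗ a`. -/
def flip : SpatialTensor A A →⋆ₐ[ℂ] SpatialTensor A A :=
  lift ((incl A A).comp (algFlip A)) (fun x => (norm_incl A A _).le.trans
    (spatialNorm_le fun π σ =>
      (norm_tensorRep_algFlip_le A π σ x).trans (norm_tensorRep_le σ π x)))

theorem flip_incl_tmul (a b : A) : flip A (incl A A (a ⊗ₜ b)) = incl A A (b ⊗ₜ a) :=
  lift_incl _ _ _

end SpatialTensor

end SpatialTensor

/-! ## Algebraic quantum metrics -/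

section QuantumMetric

open SpatialTensor

variable (A : Type u) [CStarAlgebra A]

/-- The multiplication `a ⊗ b ↦ a * b` of `A`, on the algebraic tensor product, is continuous for
the spatial norm. -/
def HasSpatiallyContinuousMul : Prop :=
  Continuous fun x : AlgTensor A A => LinearMap.mul' ℂ A ((AlgTensor.of A A).symm x)

variable {A}

/-- The continuous extension `m : A ⊗ A → A` of the multiplication to the spatial tensor product. -/
def spatialMul (hA : HasSpatiallyContinuousMul A) : SpatialTensor A A →L[ℂ] A :=
  SpatialTensor.extend (LinearMap.mul' ℂ A) hA

theorem spatialMul_incl_tmul (hA : HasSpatiallyContinuousMul A) (a b : A) :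
    spatialMul hA (incl A A (a ⊗ₜ b)) = a * b :=
  (extend_incl _ _ _).trans (LinearMap.mul'_apply)

variable (A)

/-- The ⋆-homomorphism `a ⊗ b ↦ a ⊗ 1 ⊗ b`. -/
def legOneThree : SpatialTensor A A →⋆ₐ[ℂ] SpatialTensor (SpatialTensor A A) A :=
  SpatialTensor.map (inl A A) (StarAlgHom.id ℂ A)

/-- The ⋆-homomorphism `ρ ↦ ρ ⊗ 1`, that is, `a ⊗ b ↦ a ⊗ b ⊗ 1`. -/
def legOneTwo : SpatialTensor A A →⋆ₐ[ℂ] SpatialTensor (SpatialTensor A A) A :=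
  inl (SpatialTensor A A) A

/-- The ⋆-homomorphism `ρ ↦ 1 ⊗ ρ`, that is, `a ⊗ b ↦ 1 ⊗ a ⊗ b`. -/
def legTwoThree : SpatialTensor A A →⋆ₐ[ℂ] SpatialTensor (SpatialTensor A A) A :=
  SpatialTensor.map (inr A A) (StarAlgHom.id ℂ A)

variable {A}

/-- `(A, ρ)` is an algebraic compact quantum metric space: the multiplication `m` of `A` is
continuous for the spatial norm, and `ρ` is an algebraic quantum metric. -/
structure IsAlgebraicQuantumMetric (ρ : SpatialTensor A A) : Prop where
  hasSpatiallyContinuousMul : HasSpatiallyContinuousMul A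
  nonneg : 0 ≤ ρ
  mul_eq_zero : spatialMul hasSpatiallyContinuousMul ρ = 0
  isUnit_add : ∀ ν : SpatialTensor A A, 0 ≤ ν → spatialMul hasSpatiallyContinuousMul ν = 1 →
    SpatialTensor.flip A ν = ν → IsUnit (ρ + ν)
  flip_eq : SpatialTensor.flip A ρ = ρ
  triangle : legOneThree A ρ ≤ legOneTwo A ρ + legTwoThree A ρ

variable {A₁ A₂ : Type u} [CStarAlgebra A₁] [CStarAlgebra A₂]

/-- The element of `(A₁ ⊗ A₂) ⊗ (A₁ ⊗ A₂)` corresponding to `ρ₁ ⊗ 1 + 1 ⊗ ρ₂` under the canonical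
isomorphism `(A₁ ⊗ A₁) ⊗ (A₂ ⊗ A₂) ≅ (A₁ ⊗ A₂) ⊗ (A₁ ⊗ A₂)`,
`(a ⊗ a') ⊗ (b ⊗ b') ↦ (a ⊗ b) ⊗ (a' ⊗ b')`. On elementary tensors this isomorphism maps
`(a ⊗ a') ⊗ (1 ⊗ 1)` to `(a ⊗ 1) ⊗ (a' ⊗ 1)` and `(1 ⊗ 1) ⊗ (b ⊗ b')` to `(1 ⊗ b) ⊗ (1 ⊗ b')`. -/
def productMetric (ρ₁ : SpatialTensor A₁ A₁) (ρ₂ : SpatialTensor A₂ A₂) :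
    SpatialTensor (SpatialTensor A₁ A₂) (SpatialTensor A₁ A₂) :=
  SpatialTensor.map (inl A₁ A₂) (inl A₁ A₂) ρ₁ + SpatialTensor.map (inr A₁ A₂) (inr A₁ A₂) ρ₂

theorem productMetric_incl_tmul (a a' : A₁) (b b' : A₂) :
    productMetric (incl A₁ A₁ (a ⊗ₜ a')) (incl A₂ A₂ (b ⊗ₜ b')) =
      incl _ _ (incl A₁ A₂ (a ⊗ₜ 1) ⊗ₜ incl A₁ A₂ (a' ⊗ₜ 1)) +
        incl _ _ (incl A₁ A₂ (1 ⊗ₜ b) ⊗ₜ incl A₁ A₂ (1 ⊗ₜ b')) := by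
  rw [productMetric, map_incl_tmul, map_incl_tmul]; rfl

end QuantumMetric

end

/-! ## Star homomorphisms of C⋆-algebras -/

section StarHom

variable {A B : Type*} [CStarAlgebra A] [CStarAlgebra B]

/-! Write `A` for the commutative factor and `B` for the other. Commutativity of `A` makes the image
of `A ⊗ A` in `(A ⊗ B) ⊗ (A ⊗ B)` central, so this algebra can be studied as a bundle over the
characters `ω` of `A ⊗ A`, with fibre `B ⊗ B` and evaluation map `doubleSlice`. A self-adjoint
element with invertible fibres is invertible (`isUnit_of_forall_fibre`); hence norms are also
controlled fibrewise (`norm_le_of_forall_fibre`).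

The invertibility axiom is the heart of the matter. The fibre of `ρ + ν` at `ω` is `ω ρ₁ • 1 + ρ₂ +
ν_ω`. If `ω ρ₁ > 0`, it dominates a positive scalar. If `ω ρ₁ = 0`, then `ω` lies on the diagonal,
because `ρ₁` vanishes nowhere else (`IsAlgebraicQuantumMetric.comp_inl_eq_comp_inr`); both legs are
then sliced by the same character, so `ν_ω` is again positive, flip-invariant and of multiplication
`1`, and the axiom for `ρ₂` applies.

Slicing `A ⊗ B` by characters of `A` bounds its multiplication by that of `B`
(`HasSpatiallyContinuousMul.spatialTensor`). The remaining axioms follow from naturality of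
multiplication, flip and leg maps under star homomorphisms. -/

theorem StarAlgHom.continuous_of_cstar (φ : A →⋆ₐ[ℂ] B) : Continuous φ :=
  AddMonoidHomClass.continuous_of_bound φ 1 fun x => by
    simpa using NonUnitalStarAlgHom.norm_apply_le φ x

/-- A star homomorphism of C⋆-algebras which is bounded below is isometric. -/
theorem StarAlgHom.norm_map_of_le_mul (φ : A →⋆ₐ[ℂ] B) {C : ℝ}
    (h : ∀ x, ‖x‖ ≤ C * ‖φ x‖) (x : A) : ‖φ x‖ = ‖x‖ := by
  have key (y : A) (hy : IsSelfAdjoint y) : ‖y‖ ≤ ‖φ y‖ := by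
    by_contra! hlt
    have hy0 : 0 < ‖y‖ := (norm_nonneg _).trans_lt hlt
    -- Norms of self-adjoint elements are multiplicative on powers `2 ^ n`, so a strict norm
    -- decrease would beat any constant `C`.
    have hpow (n : ℕ) : 1 ≤ C * (‖φ y‖ / ‖y‖) ^ (2 ^ n) := by
      have h1 := h (y ^ 2 ^ n)
      rw [map_pow] at h1
      have e1 : ‖y ^ 2 ^ n‖ = ‖y‖ ^ 2 ^ n :=
        congrArg NNReal.toReal (hy.nnnorm_pow_two_pow n)
      have e2 : ‖φ y ^ 2 ^ n‖ = ‖φ y‖ ^ 2 ^ n :=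
        congrArg NNReal.toReal ((hy.map φ).nnnorm_pow_two_pow n)
      rw [e1, e2] at h1
      rw [div_pow, ← mul_div_assoc, le_div_iff₀ (by positivity)]
      linarith
    have hlim : Filter.Tendsto (fun n : ℕ => C * (‖φ y‖ / ‖y‖) ^ (2 ^ n)) Filter.atTop
        (nhds (C * 0)) :=
      ((tendsto_pow_atTop_nhds_zero_of_lt_one (by positivity)
        ((div_lt_one hy0).2 hlt)).comp
          (tendsto_pow_atTop_atTop_of_one_lt one_lt_two)).const_mul C
    have := ge_of_tendsto' hlim hpow
    linarith
  refine le_antisymm (NonUnitalStarAlgHom.norm_apply_le φ x) ?_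
  have h1 := key (star x * x) (.star_mul_self x)
  rw [map_mul, map_star, CStarRing.norm_star_mul_self, CStarRing.norm_star_mul_self] at h1
  exact le_of_sq_le_sq (by simpa only [sq] using h1) (norm_nonneg _)

end StarHom

/-! ## Invertibility and norm are detected fibrewise -/

section Fibres

open scoped ComplexOrder

variable {C B M : Type*} [CStarAlgebra C] [CStarAlgebra B] [CStarAlgebra M]
  [PartialOrder M] [StarOrderedRing M]

/-- Conjugate `star u * u ≤ ‖u‖ ^ 2` by `v`. This turns invertibility in a fibre into an inequality
that can be transported to `M`. -/
theorem one_le_norm_sq_smul_of_mul_eq_one {u v : M} (h : u * v = 1) :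
    1 ≤ ‖u‖ ^ 2 • (star v * v) := by
  have h1 := star_left_conjugate_le_conjugate
    (CStarAlgebra.star_mul_le_algebraMap_norm_sq (a := u)) v
  have e : star v * (star u * u) * v = 1 := by
    rw [show star v * (star u * u) * v = star (u * v) * (u * v) by
      rw [star_mul]; simp only [mul_assoc], h, star_one, one_mul]
  rw [e] at h1
  simpa [Algebra.algebraMap_eq_smul_one] using h1

/-- By the parallelogram identity, the difference of the two sides is `star (a - b) * (a - b)`. -/
theorem star_mul_self_add_le (a b : M) :
    star (a + b) * (a + b) ≤ (2 : ℝ) • (star a * a) + (2 : ℝ) • (star b * b) := by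
  rw [← sub_nonneg]
  have : (2 : ℝ) • (star a * a) + (2 : ℝ) • (star b * b) - star (a + b) * (a + b) =
      star (a - b) * (a - b) := by
    simp only [two_smul, star_add, star_sub]
    noncomm_ring
  rw [this]
  exact star_mul_self_nonneg _

/-- `k` is infinitesimal at `ω` if `k⋆ k` is dominated, up to arbitrarily small constants, by
elements of the kernel of the character `ω` of a central subalgebra. -/
def IsInfinitesimalAt (ι : C →⋆ₐ[ℂ] M) (ω : C →⋆ₐ[ℂ] ℂ) (k : M) : Prop :=
  ∀ ε : ℝ, 0 < ε → ∃ g : C, ω g = 0 ∧ star k * k ≤ ι g + algebraMap ℝ M ε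

variable {ι : C →⋆ₐ[ℂ] M} {ω : C →⋆ₐ[ℂ] ℂ}

namespace IsInfinitesimalAt

theorem zero : IsInfinitesimalAt ι ω 0 := fun ε hε =>
  ⟨0, map_zero _, by simpa using (algebraMap_nonneg M hε.le)⟩

theorem add {k l : M} (hk : IsInfinitesimalAt ι ω k) (hl : IsInfinitesimalAt ι ω l) :
    IsInfinitesimalAt ι ω (k + l) := by
  intro ε hε
  obtain ⟨g, hg, hkg⟩ := hk (ε / 4) (by positivity)
  obtain ⟨g', hg', hlg⟩ := hl (ε / 4) (by positivity)
  refine ⟨(2 : ℂ) • g + (2 : ℂ) • g', by simp [hg, hg'], (star_mul_self_add_le k l).trans ?_⟩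
  calc _ ≤ (2 : ℝ) • (ι g + algebraMap ℝ M (ε / 4)) + (2 : ℝ) • (ι g' + algebraMap ℝ M (ε / 4)) :=
        add_le_add (smul_le_smul_of_nonneg_left hkg zero_le_two)
          (smul_le_smul_of_nonneg_left hlg zero_le_two)
    _ = _ := by
        have : algebraMap ℝ M ε = (4 : ℝ) • algebraMap ℝ M (ε / 4) := by
          rw [Algebra.algebraMap_eq_smul_one, Algebra.algebraMap_eq_smul_one, smul_smul]
          congr 1; ring
        rw [this, map_add, map_smul, map_smul]
        have h2 (x : M) : (2 : ℂ) • x = (2 : ℝ) • x := by simp [two_smul]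
        rw [h2, h2]
        module

theorem smul {k : M} (hk : IsInfinitesimalAt ι ω k) (c : ℂ) : IsInfinitesimalAt ι ω (c • k) := by
  intro ε hε
  -- The summand `1` keeps the denominator positive when `c = 0`.
  obtain ⟨g, hg, hkg⟩ := hk (ε / (‖c‖ ^ 2 + 1)) (by positivity)
  refine ⟨((‖c‖ ^ 2 : ℝ) : ℂ) • g, by simp [hg], ?_⟩
  calc star (c • k) * (c • k) = (‖c‖ ^ 2 : ℝ) • (star k * k) := by
        rw [star_smul, smul_mul_smul_comm, ← Complex.coe_smul]
        congr 1
        rw [Complex.star_def, Complex.conj_mul']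
        push_cast; rfl
    _ ≤ (‖c‖ ^ 2 : ℝ) • (ι g + algebraMap ℝ M (ε / (‖c‖ ^ 2 + 1))) :=
        smul_le_smul_of_nonneg_left hkg (by positivity)
    _ ≤ _ := by
        rw [smul_add, map_smul, Complex.coe_smul, Algebra.algebraMap_eq_smul_one,
          Algebra.algebraMap_eq_smul_one, smul_smul]
        refine add_le_add le_rfl (smul_le_smul_of_nonneg_right ?_ zero_le_one)
        rw [← mul_div_assoc, div_le_iff₀ (by positivity)]
        nlinarith

theorem of_mem_closure {k : M} (hk : k ∈ closure {l | IsInfinitesimalAt ι ω l}) :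
    IsInfinitesimalAt ι ω k := by
  intro ε hε
  obtain ⟨l, hl, hkl⟩ := Metric.mem_closure_iff.1 hk (√(ε / 4)) (Real.sqrt_pos.2 (by positivity))
  obtain ⟨g, hg, hlg⟩ := hl (ε / 4) (by positivity)
  refine ⟨(2 : ℂ) • g, by simp [hg], ?_⟩
  rw [dist_eq_norm] at hkl
  have h1 : ‖k - l‖ ^ 2 ≤ ε / 4 := by
    have := pow_le_pow_left₀ (norm_nonneg _) hkl.le 2
    rwa [Real.sq_sqrt (by positivity)] at this
  calc star k * k = star (l + (k - l)) * (l + (k - l)) := by rw [add_sub_cancel]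
    _ ≤ _ := star_mul_self_add_le l (k - l)
    _ ≤ (2 : ℝ) • (ι g + algebraMap ℝ M (ε / 4)) + (2 : ℝ) • algebraMap ℝ M (ε / 4) :=
        add_le_add (smul_le_smul_of_nonneg_left hlg zero_le_two)
          (smul_le_smul_of_nonneg_left
            (CStarAlgebra.star_mul_le_algebraMap_norm_sq.trans (algebraMap_mono M h1)) zero_le_two)
    _ = _ := by
        have : algebraMap ℝ M ε = (4 : ℝ) • algebraMap ℝ M (ε / 4) := by
          rw [Algebra.algebraMap_eq_smul_one, Algebra.algebraMap_eq_smul_one, smul_smul]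
          congr 1; ring
        rw [this, map_smul]
        have h2 (x : M) : (2 : ℂ) • x = (2 : ℝ) • x := by simp [two_smul]
        rw [h2]
        module

/-- Centrality gives `star (ι c * m) * (ι c * m) ≤ ‖m‖ ^ 2 • ι (star c * c)`, and `ω` kills `star c
* c`. -/
theorem of_map_eq_zero (hι : ∀ c m, Commute (ι c) m) {c : C} (hc : ω c = 0) (m : M) :
    IsInfinitesimalAt ι ω (ι c * m) := by
  intro ε hε
  refine ⟨((‖m‖ ^ 2 : ℝ) : ℂ) • (star c * c), by simp [hc], ?_⟩
  have h1 := star_left_conjugate_le_conjugate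
    (CStarAlgebra.star_mul_le_algebraMap_norm_sq (a := m)) (ι c)
  have h2 : star (ι c * m) * (ι c * m) = star (ι c) * (star m * m) * ι c := by
    rw [(hι c m).eq, star_mul]; simp only [mul_assoc]
  rw [h2]
  refine (h1.trans (le_of_eq ?_)).trans (le_add_of_nonneg_right (algebraMap_nonneg M hε.le))
  rw [map_smul, map_mul, map_star, Complex.coe_smul]
  simp [Algebra.algebraMap_eq_smul_one]

end IsInfinitesimalAt

/-! ### Fibrewise criteria for invertibility and norm. -/

variable {j : B →⋆ₐ[ℂ] M} {E : (C →⋆ₐ[ℂ] ℂ) → M →⋆ₐ[ℂ] B}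

/-- An element agrees with the constant section through its value at `ω`, up to an infinitesimal.
The elements with this property form a closed subspace, and for a generator the difference is `ι (c
- ω c) * j b`. -/
theorem isInfinitesimalAt_sub (hι : ∀ c m, Commute (ι c) m)
    (hE : ∀ ω c b, E ω (ι c * j b) = ω c • b)
    (hdense : ∀ K : Submodule ℂ M, IsClosed (K : Set M) → (∀ c b, ι c * j b ∈ K) → K = ⊤)
    (ω : C →⋆ₐ[ℂ] ℂ) (m : M) : IsInfinitesimalAt ι ω (m - j (E ω m)) := by
  let N : Submodule ℂ M :=
    { carrier := {k | IsInfinitesimalAt ι ω k}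
      zero_mem' := .zero
      add_mem' := fun h h' => h.add h'
      smul_mem' := fun c _ h => h.smul c }
  let f : M →ₗ[ℂ] M := LinearMap.id - (j.comp (E ω)).toAlgHom.toLinearMap
  have hf : Continuous f :=
    continuous_id.sub (j.comp (E ω)).continuous_of_cstar
  have hN : IsClosed (N : Set M) := isClosed_of_closure_subset fun k hk => .of_mem_closure hk
  have := hdense (N.comap f) (hN.preimage hf) (fun c b => by
    change IsInfinitesimalAt ι ω (ι c * j b - j (E ω (ι c * j b)))
    have e : ι c * j b - j (E ω (ι c * j b)) = ι (c - algebraMap ℂ C (ω c)) * j b := by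
      rw [hE, map_smul, map_sub, AlgHomClass.commutes, sub_mul, Algebra.smul_def]
    rw [e]
    exact .of_map_eq_zero hι (by rw [map_sub, AlgHomClass.commutes]; exact sub_self _) _)
  exact (this ▸ Submodule.mem_top : m ∈ N.comap f)

/-- The closed commutative star subalgebra generated by a central subalgebra and a self-adjoint
element has a character vanishing at any given non-invertible element. -/
theorem exists_character_apply_eq_zero (hι : ∀ c m, Commute (ι c) m) {w : M}
    (hw : IsSelfAdjoint w) (hu : ¬ IsUnit w) :
    ∃ ω : C →⋆ₐ[ℂ] ℂ, ∀ (g : C) (r : ℂ), ω g = 0 → ¬ IsUnit (r • (w * w + ι g)) := by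
  let T : Set M := insert w (Set.range ι)
  -- The bicommutant of `T` is closed, being a centralizer, and commutative, since `T` is commuting
  -- and closed under star.
  let S : StarSubalgebra ℂ M := StarSubalgebra.centralizer ℂ (StarSubalgebra.centralizer ℂ T : Set M)
  have hS : IsClosed (S : Set M) := Set.isClosed_centralizer _
  have hTS : T ⊆ S := by
    rw [show (S : Set M) = _ from StarSubalgebra.coe_centralizer_centralizer ℂ T]
    exact Set.subset_union_left.trans Set.subset_centralizer_centralizer
  have hcomm : ∀ x y : S, x * y = y * x := by
    have hT : ∀ x ∈ T, ∀ y ∈ T, x * y = y * x := by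
      rintro x (rfl | ⟨c, rfl⟩) y (rfl | ⟨d, rfl⟩)
      · rfl
      · exact (hι d x).eq.symm
      · exact (hι c y).eq
      · exact (hι c _).eq
    have hstar : ∀ x ∈ T, star x ∈ T := by
      rintro x (rfl | ⟨c, rfl⟩)
      · exact Or.inl hw
      · exact Or.inr ⟨star c, map_star _ _⟩
    have hT' : T ⊆ (StarSubalgebra.centralizer ℂ T : Set M) := fun x hx =>
      StarSubalgebra.mem_centralizer_iff ℂ |>.2 fun y hy =>
        ⟨hT _ hy _ hx, hT _ (hstar _ hy) _ hx⟩
    rintro ⟨x, hx⟩ ⟨y, hy⟩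
    have hy' : y ∈ StarSubalgebra.centralizer ℂ T :=
      StarSubalgebra.centralizer_le ℂ _ _ hT' hy
    exact Subtype.ext ((StarSubalgebra.mem_centralizer_iff ℂ).1 hx y hy').1.symm
  let _ : CommCStarAlgebra S := { (inferInstance : CStarAlgebra S) with mul_comm := hcomm }
  let w' : S := ⟨w, hTS (Set.mem_insert _ _)⟩
  have hw' : ¬ IsUnit w' := fun h => hu (h.map S.subtype)
  obtain ⟨θ, hθ⟩ := WeakDual.CharacterSpace.exists_apply_eq_zero hw'
  let ι' : C →⋆ₐ[ℂ] S := ι.codRestrict S fun c => hTS (Or.inr ⟨c, rfl⟩)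
  let θ' : S →⋆ₐ[ℂ] ℂ := StarAlgHomClass.toStarAlgHom θ
  refine ⟨θ'.comp ι', fun g r hg h => ?_⟩
  -- An element of a closed star subalgebra that is invertible in `M` is invertible in the
  -- subalgebra, where the character `θ'` sends it to `0`.
  have h1 : IsUnit (r • (w' * w' + ι' g)) := S.coe_isUnit.1 h
  have h2 := h1.map θ'
  have h3 : θ' w' = 0 := hθ
  have h4 : θ' (ι' g) = 0 := hg
  rw [map_smul, map_add, map_mul, h3, h4] at h2
  simp at h2

/-- A self-adjoint element all of whose fibres are invertible is invertible. -/
theorem isUnit_of_forall_fibre (hι : ∀ c m, Commute (ι c) m)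
    (hE : ∀ ω c b, E ω (ι c * j b) = ω c • b)
    (hdense : ∀ K : Submodule ℂ M, IsClosed (K : Set M) → (∀ c b, ι c * j b ∈ K) → K = ⊤)
    {w : M} (hw : IsSelfAdjoint w) (h : ∀ ω, IsUnit (E ω w)) : IsUnit w := by
  by_contra hu
  obtain ⟨ω, hω⟩ := exists_character_apply_eq_zero hι hw hu
  obtain ⟨u, huv⟩ := (h ω).exists_left_inv
  set v := E ω w
  have h1 := one_le_norm_sq_smul_of_mul_eq_one (u := j u) (v := j v)
    (by rw [← map_mul, huv, map_one])
  set N := ‖j u‖ ^ 2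
  have hN : 0 ≤ N := by positivity
  -- The error is doubled by `star_mul_self_add_le` and then multiplied by `N`; with this constant
  -- it ends as `N / (2 * (N + 1)) ≤ 1 / 2`.
  obtain ⟨g, hg, hkg⟩ := (isInfinitesimalAt_sub hι hE hdense ω w).smul (-1)
    (1 / (4 * (N + 1))) (by positivity)
  -- It remains to bound `2 * N • (w * w + ι g)` below by `1 / 2`. This contradicts the choice of
  -- `ω`, whose extending character kills both `w` and `ι g`.
  refine hω g ((2 * N : ℝ) : ℂ) hg ?_
  have h2 : star (j v) * j v ≤ (2 : ℝ) • (w * w + ι g) +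
      algebraMap ℝ M (1 / (2 * (N + 1))) := by
    have e : j v = w + (-1 : ℂ) • (w - j v) := by simp
    calc star (j v) * j v ≤ (2 : ℝ) • (star w * w) +
          (2 : ℝ) • (star ((-1 : ℂ) • (w - j v)) * ((-1 : ℂ) • (w - j v))) := by
          conv_lhs => rw [e]
          exact star_mul_self_add_le _ _
      _ ≤ (2 : ℝ) • (star w * w) + (2 : ℝ) • (ι g + algebraMap ℝ M (1 / (4 * (N + 1)))) :=
          add_le_add le_rfl (smul_le_smul_of_nonneg_left hkg zero_le_two)
      _ = _ := by
          rw [hw.star_eq, smul_add, smul_add, Algebra.algebraMap_eq_smul_one,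
            Algebra.algebraMap_eq_smul_one, smul_smul, add_assoc,
            show (2 : ℝ) * (1 / (4 * (N + 1))) = 1 / (2 * (N + 1)) by field_simp; norm_num]
  have h3 : algebraMap ℝ M (1 / 2) ≤ ((2 * N : ℝ) : ℂ) • (w * w + ι g) := by
    have h4 : (1 : M) ≤ (2 * N) • (w * w + ι g) + algebraMap ℝ M (1 / 2) := by
      refine (h1.trans (smul_le_smul_of_nonneg_left h2 hN)).trans ?_
      rw [smul_add, smul_smul, mul_comm N 2, Algebra.algebraMap_eq_smul_one,
        Algebra.algebraMap_eq_smul_one, smul_smul]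
      refine add_le_add le_rfl (smul_le_smul_of_nonneg_right ?_ zero_le_one)
      rw [← mul_div_assoc, div_le_div_iff₀ (by positivity) (by positivity)]
      linarith
    rw [Complex.coe_smul]
    rw [← sub_le_iff_le_add] at h4
    refine le_trans (le_of_eq ?_) h4
    rw [Algebra.algebraMap_eq_smul_one]
    nth_rw 2 [← one_smul ℝ (1 : M)]
    rw [← sub_smul]; norm_num
  exact CStarAlgebra.isUnit_of_le _ h3 (isStrictlyPositive_algebraMap (by norm_num))

/-- The norm is the supremum of the norms of the fibres. -/
theorem norm_le_of_forall_fibre (hι : ∀ c m, Commute (ι c) m)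
    (hE : ∀ ω c b, E ω (ι c * j b) = ω c • b)
    (hdense : ∀ K : Submodule ℂ M, IsClosed (K : Set M) → (∀ c b, ι c * j b ∈ K) → K = ⊤)
    {h : M} {r : ℝ} (hr : 0 ≤ r) (hh : ∀ ω, ‖E ω h‖ ≤ r) : ‖h‖ ≤ r := by
  by_contra! hlt
  have : Nontrivial M := ⟨h, 0, fun h0 => by rw [h0, norm_zero] at hlt; linarith⟩
  have hmem := CStarAlgebra.norm_mem_spectrum_of_nonneg (star_mul_self_nonneg h)
  rw [CStarRing.norm_star_mul_self] at hmem
  -- A fibre of `‖h‖ ^ 2 - star h * h` could fail to be invertible only if `‖h‖ ^ 2 ≤ ‖E ω h‖ ^ 2 ≤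
  -- r ^ 2`.
  refine hmem (isUnit_of_forall_fibre hι hE hdense ?_ fun ω => ?_)
  · exact (IsSelfAdjoint.algebraMap M (.all _)).sub (.star_mul_self h)
  · by_contra hnu
    have h1 : (‖h‖ * ‖h‖ : ℝ) ∈ spectrum ℝ (star (E ω h) * E ω h) := by
      rw [spectrum.mem_iff]
      convert hnu using 2
      rw [map_sub, map_mul (E ω) (star h), map_star]
      congr 1
      rw [Algebra.algebraMap_eq_smul_one, Algebra.algebraMap_eq_smul_one, ← Complex.coe_smul,
        ← Complex.coe_smul, map_smul, map_one]
    have : Nontrivial B := ⟨E ω h * 0, 1, fun h0 => by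
      have : Subsingleton B := subsingleton_of_zero_eq_one (by simpa using h0)
      exact hnu (isUnit_of_subsingleton _)⟩
    have h2 := spectrum.norm_le_norm_of_mem h1
    rw [CStarRing.norm_star_mul_self, Real.norm_of_nonneg (by positivity)] at h2
    nlinarith [hh ω, norm_nonneg (E ω h)]

end Fibres

/-! ## Maps on spatial tensor products -/

namespace SpatialTensor

section Ext

variable {A B A' B' : Type u} [CStarAlgebra A] [CStarAlgebra B] [CStarAlgebra A'] [CStarAlgebra B']

/-- The density principle behind the identities below: equalizers of continuous linear maps are
closed subspaces, so elementary tensors suffice. -/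
theorem mem_of_forall_tmul {K : Submodule ℂ (SpatialTensor A B)}
    (hK : IsClosed (K : Set (SpatialTensor A B)))
    (h : ∀ a b, incl A B (a ⊗ₜ b) ∈ K) (x : SpatialTensor A B) : x ∈ K := by
  induction x using induction_incl with
  | hp => exact hK
  | ih x =>
    induction x with
    | zero => rw [map_zero]; exact K.zero_mem
    | add x y hx hy => rw [map_add]; exact K.add_mem hx hy
    | tmul a b => exact h a b

theorem starAlgHom_ext {D : Type*} [CStarAlgebra D] {f g : SpatialTensor A B →⋆ₐ[ℂ] D}
    (h : ∀ a b, f (incl A B (a ⊗ₜ b)) = g (incl A B (a ⊗ₜ b))) : f = g := by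
  ext x
  exact mem_of_forall_tmul
    (K := LinearMap.eqLocus f.toAlgHom.toLinearMap g.toAlgHom.toLinearMap)
    (isClosed_eq f.continuous_of_cstar g.continuous_of_cstar) h x

theorem inl_mul_inr (a : A) (b : B) : inl A B a * inr A B b = incl A B (a ⊗ₜ b) := by
  rw [inl_apply, inr_apply, ← map_mul, Algebra.TensorProduct.tmul_mul_tmul, mul_one, one_mul]

theorem incl_tmul_mul (a a' : A) (b b' : B) :
    incl A B (a ⊗ₜ b) * incl A B (a' ⊗ₜ b') = incl A B ((a * a') ⊗ₜ (b * b')) := by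
  rw [← map_mul, Algebra.TensorProduct.tmul_mul_tmul]

theorem incl_one_tmul_one : incl A B (1 ⊗ₜ 1) = 1 := map_one (incl A B)

theorem commute_of_forall_tmul {y : SpatialTensor A B}
    (h : ∀ a b, Commute y (incl A B (a ⊗ₜ b))) (x : SpatialTensor A B) : Commute y x :=
  mem_of_forall_tmul
    (K := LinearMap.eqLocus (LinearMap.mulLeft ℂ y) (LinearMap.mulRight ℂ y))
    (isClosed_eq (continuous_const_mul y) (continuous_mul_const y)) h x

theorem commute_inl (hA : ∀ a a' : A, a * a' = a' * a) (a : A) (x : SpatialTensor A B) :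
    Commute (inl A B a) x :=
  commute_of_forall_tmul (fun a' b => by
    rw [Commute, SemiconjBy, inl_apply, incl_tmul_mul, incl_tmul_mul, hA, one_mul, mul_one]) x

theorem commute_map {φ : A →⋆ₐ[ℂ] A'} {ψ : B →⋆ₐ[ℂ] B'} (hφ : ∀ a x, Commute (φ a) x)
    (hψ : ∀ b y, Commute (ψ b) y) (c : SpatialTensor A B) (x : SpatialTensor A' B') :
    Commute (map φ ψ c) x := by
  refine (commute_of_forall_tmul (fun a' b' => ?_) x)
  exact mem_of_forall_tmul
    (K := LinearMap.eqLocus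
      ((LinearMap.mulRight ℂ (incl A' B' (a' ⊗ₜ b'))).comp (map φ ψ).toAlgHom.toLinearMap)
      ((LinearMap.mulLeft ℂ (incl A' B' (a' ⊗ₜ b'))).comp (map φ ψ).toAlgHom.toLinearMap))
    (isClosed_eq ((continuous_mul_const _).comp (map φ ψ).continuous_of_cstar)
      ((continuous_const_mul _).comp (map φ ψ).continuous_of_cstar))
    (fun a b => by
      change map φ ψ (incl A B (a ⊗ₜ b)) * _ = _ * map φ ψ (incl A B (a ⊗ₜ b))
      rw [map_incl_tmul, incl_tmul_mul, incl_tmul_mul, (hφ a a').eq, (hψ b b').eq]) c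

theorem eq_top_of_inl_mul_inr_mem (K : Submodule ℂ (SpatialTensor A B))
    (hK : IsClosed (K : Set (SpatialTensor A B)))
    (h : ∀ a b, inl A B a * inr A B b ∈ K) : K = ⊤ :=
  eq_top_iff.2 fun x _ => mem_of_forall_tmul hK (fun a b => inl_mul_inr a b ▸ h a b) x

/-- `(A ⊗ B) ⊗ (A' ⊗ B')` is generated by the images of `A ⊗ A'` and `B ⊗ B'`. -/
theorem eq_top_of_map_inl_mul_map_inr_mem
    (K : Submodule ℂ (SpatialTensor (SpatialTensor A B) (SpatialTensor A' B')))
    (hK : IsClosed (K : Set (SpatialTensor (SpatialTensor A B) (SpatialTensor A' B'))))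
    (h : ∀ c d, map (inl A B) (inl A' B') c * map (inr A B) (inr A' B') d ∈ K) : K = ⊤ := by
  refine eq_top_of_inl_mul_inr_mem K hK fun x y => ?_
  refine mem_of_forall_tmul (K := K.comap ((LinearMap.mulRight ℂ (inr _ _ y)).comp
    (inl (SpatialTensor A B) (SpatialTensor A' B')).toAlgHom.toLinearMap))
    (hK.preimage ((continuous_mul_const _).comp (inl _ _).continuous_of_cstar)) (fun a b => ?_) x
  refine mem_of_forall_tmul (K := K.comap ((LinearMap.mulLeft ℂ (inl _ _ (incl A B (a ⊗ₜ b)))).comp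
    (inr (SpatialTensor A B) (SpatialTensor A' B')).toAlgHom.toLinearMap))
    (hK.preimage ((continuous_const_mul _).comp (inr _ _).continuous_of_cstar)) (fun a' b' => ?_) y
  have := h (incl A A' (a ⊗ₜ a')) (incl B B' (b ⊗ₜ b'))
  rw [map_incl_tmul, map_incl_tmul, incl_tmul_mul, inl_mul_inr, inl_mul_inr] at this
  change inl _ _ (incl A B (a ⊗ₜ b)) * inr _ _ (incl A' B' (a' ⊗ₜ b')) ∈ K
  rwa [inl_mul_inr]

end Ext

/-! ## Slice maps -/

section Slice

variable {A B : Type u} [CStarAlgebra A] [CStarAlgebra B]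

/-- The slice map `a ⊗ b ↦ χ a • b` on the algebraic tensor product. -/
noncomputable def algSlice (χ : A →⋆ₐ[ℂ] ℂ) : A ⊗[ℂ] B →⋆ₐ[ℂ] B where
  toAlgHom := Algebra.TensorProduct.lift ((Algebra.ofId ℂ B).comp (χ : A →ₐ[ℂ] ℂ))
    (AlgHom.id ℂ B) (fun a b => Algebra.commutes (χ a) b)
  map_star' x := by
    change Algebra.TensorProduct.lift ((Algebra.ofId ℂ B).comp (χ : A →ₐ[ℂ] ℂ))
      (AlgHom.id ℂ B) (fun a b => Algebra.commutes (χ a) b) (star x) =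
      star (Algebra.TensorProduct.lift ((Algebra.ofId ℂ B).comp (χ : A →ₐ[ℂ] ℂ))
      (AlgHom.id ℂ B) (fun a b => Algebra.commutes (χ a) b) x)
    induction x with
    | zero => simp
    | add x y hx hy => simp only [star_add, map_add, hx, hy]
    | tmul a b =>
      change algebraMap ℂ B (χ (star a)) * star b = star (algebraMap ℂ B (χ a) * b)
      rw [star_mul, map_star, Algebra.commutes, algebraMap_star_comm]

theorem algSlice_tmul (χ : A →⋆ₐ[ℂ] ℂ) (a : A) (b : B) :
    algSlice χ (a ⊗ₜ b) = χ a • b :=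
  (Algebra.smul_def _ _).symm

/-- If the multiplication of `B` is spatially continuous, then `b ↦ 1 ⊗ b` is isometric. -/
theorem norm_inr_of_hasSpatiallyContinuousMul (hB : HasSpatiallyContinuousMul B) (b : B) :
    ‖inr B B b‖ = ‖b‖ := by
  refine (inr B B).norm_map_of_le_mul (C := ‖spatialMul hB‖) (fun b => ?_) b
  calc ‖b‖ = ‖spatialMul hB (inr B B b)‖ := by
        rw [inr_apply, spatialMul_incl_tmul, one_mul]
    _ ≤ _ := (spatialMul hB).le_opNorm _

/-- Following the slice by the isometry `b ↦ 1 ⊗ b` gives the star homomorphism `χ(·)1 ⊗ id` into `B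
⊗ B`, which is contractive. -/
theorem norm_algSlice_le (hB : HasSpatiallyContinuousMul B) (χ : A →⋆ₐ[ℂ] ℂ) (z : A ⊗[ℂ] B) :
    ‖algSlice χ z‖ ≤ spatialNorm z := by
  have key : inr B B (algSlice χ z) =
      map ((StarAlgHom.ofId ℂ B).comp χ) (StarAlgHom.id ℂ B) (incl A B z) := by
    induction z with
    | zero => simp only [map_zero]
    | add x y hx hy => simp only [map_add, hx, hy]
    | tmul a b =>
      rw [map_incl_tmul, algSlice_tmul, map_smul, inr_apply, ← map_smul,
        TensorProduct.smul_tmul']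
      congr 2
      exact (Algebra.algebraMap_eq_smul_one (χ a)).symm
  rw [← norm_inr_of_hasSpatiallyContinuousMul hB, key, ← norm_incl]
  exact NonUnitalStarAlgHom.norm_apply_le _ _

/-- The slice map `a ⊗ b ↦ χ a • b` on the spatial tensor product. -/
noncomputable def slice (hB : HasSpatiallyContinuousMul B) (χ : A →⋆ₐ[ℂ] ℂ) :
    SpatialTensor A B →⋆ₐ[ℂ] B :=
  lift (algSlice χ) (norm_algSlice_le hB χ)

theorem slice_incl_tmul (hB : HasSpatiallyContinuousMul B) (χ : A →⋆ₐ[ℂ] ℂ) (a : A) (b : B) :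
    slice hB χ (incl A B (a ⊗ₜ b)) = χ a • b :=
  (lift_incl _ _ _).trans (algSlice_tmul χ a b)

theorem slice_inl (hB : HasSpatiallyContinuousMul B) (χ : A →⋆ₐ[ℂ] ℂ) (a : A) :
    slice hB χ (inl A B a) = χ a • (1 : B) :=
  slice_incl_tmul hB χ a 1

theorem slice_inr (hB : HasSpatiallyContinuousMul B) (χ : A →⋆ₐ[ℂ] ℂ) (b : B) :
    slice hB χ (inr A B b) = b := by
  rw [inr_apply, slice_incl_tmul, map_one, one_smul]

theorem norm_le_of_forall_slice (hA : ∀ a a' : A, a * a' = a' * a)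
    (hB : HasSpatiallyContinuousMul B) {x : SpatialTensor A B} {r : ℝ} (hr : 0 ≤ r)
    (h : ∀ χ, ‖slice hB χ x‖ ≤ r) : ‖x‖ ≤ r :=
  norm_le_of_forall_fibre (ι := inl A B) (j := inr A B) (E := slice hB) (commute_inl hA)
    (fun χ a b => by rw [inl_mul_inr, slice_incl_tmul]) eq_top_of_inl_mul_inr_mem hr h

/-- The slice map `(A ⊗ B) ⊗ (A ⊗ B) → B ⊗ B` along a character of `A ⊗ A`. -/
noncomputable def doubleSlice (hB : HasSpatiallyContinuousMul B) (ω : SpatialTensor A A →⋆ₐ[ℂ] ℂ) :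
    SpatialTensor (SpatialTensor A B) (SpatialTensor A B) →⋆ₐ[ℂ] SpatialTensor B B :=
  map (slice hB (ω.comp (inl A A))) (slice hB (ω.comp (inr A A)))

/-- A character of `A ⊗ A` is the product of its restrictions to the two legs, so slicing both legs
recovers `ω`. -/
theorem doubleSlice_map_inl (hB : HasSpatiallyContinuousMul B)
    (ω : SpatialTensor A A →⋆ₐ[ℂ] ℂ) (c : SpatialTensor A A) :
    doubleSlice hB ω (map (inl A B) (inl A B) c) = ω c • 1 := by
  have : (doubleSlice hB ω).comp (map (inl A B) (inl A B)) =
      (StarAlgHom.ofId ℂ (SpatialTensor B B)).comp ω := by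
    refine starAlgHom_ext fun a a' => ?_
    change doubleSlice hB ω (map (inl A B) (inl A B) (incl A A (a ⊗ₜ a'))) =
      algebraMap ℂ _ (ω (incl A A (a ⊗ₜ a')))
    rw [map_incl_tmul, doubleSlice, map_incl_tmul, slice_inl, slice_inl, ← inl_mul_inr a a', map_mul,
      Algebra.algebraMap_eq_smul_one, TensorProduct.smul_tmul_smul, map_smul, incl_one_tmul_one]
    rfl
  exact (DFunLike.congr_fun this c).trans (Algebra.algebraMap_eq_smul_one (ω c))

theorem doubleSlice_map_inr (hB : HasSpatiallyContinuousMul B)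
    (ω : SpatialTensor A A →⋆ₐ[ℂ] ℂ) (d : SpatialTensor B B) :
    doubleSlice hB ω (map (inr A B) (inr A B) d) = d := by
  have : (doubleSlice hB ω).comp (map (inr A B) (inr A B)) = StarAlgHom.id ℂ _ := by
    refine starAlgHom_ext fun b b' => ?_
    change doubleSlice hB ω (map (inr A B) (inr A B) (incl B B (b ⊗ₜ b'))) = incl B B (b ⊗ₜ b')
    rw [map_incl_tmul, doubleSlice, map_incl_tmul, slice_inr, slice_inr]
  exact DFunLike.congr_fun this d

theorem isUnit_of_forall_doubleSlice (hA : ∀ a a' : A, a * a' = a' * a)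
    (hB : HasSpatiallyContinuousMul B)
    {w : SpatialTensor (SpatialTensor A B) (SpatialTensor A B)} (hw : IsSelfAdjoint w)
    (h : ∀ ω, IsUnit (doubleSlice hB ω w)) : IsUnit w :=
  isUnit_of_forall_fibre (ι := map (inl A B) (inl A B)) (j := map (inr A B) (inr A B))
    (E := doubleSlice hB) (commute_map (commute_inl hA) (commute_inl hA))
    (fun ω c d => by
      rw [map_mul, doubleSlice_map_inl, doubleSlice_map_inr, smul_mul_assoc, one_mul])
    eq_top_of_map_inl_mul_map_inr_mem hw h

end Slice

end SpatialTensor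

/-! ## Products of algebraic quantum metrics -/

section Product

open SpatialTensor

variable {A B : Type u} [CStarAlgebra A] [CStarAlgebra B]

/-! ### Spatial continuity of the multiplication of a tensor product. -/

theorem spatialMul_mul (hA : ∀ a a' : A, a * a' = a' * a) (hm : HasSpatiallyContinuousMul A)
    (x y : SpatialTensor A A) : spatialMul hm (x * y) = spatialMul hm x * spatialMul hm y := by
  have hc := (spatialMul hm).continuous
  refine mem_of_forall_tmul (K := LinearMap.eqLocus
    ((spatialMul hm : SpatialTensor A A →ₗ[ℂ] A) ∘ₗ LinearMap.mulRight ℂ y)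
    (LinearMap.mulRight ℂ (spatialMul hm y) ∘ₗ (spatialMul hm : SpatialTensor A A →ₗ[ℂ] A)))
    (isClosed_eq (hc.comp (continuous_mul_const y)) ((continuous_mul_const _).comp hc))
    (fun a b => ?_) x
  refine mem_of_forall_tmul (K := LinearMap.eqLocus
    ((spatialMul hm : SpatialTensor A A →ₗ[ℂ] A) ∘ₗ LinearMap.mulLeft ℂ (incl A A (a ⊗ₜ b)))
    (LinearMap.mulLeft ℂ (spatialMul hm (incl A A (a ⊗ₜ b))) ∘ₗ
      (spatialMul hm : SpatialTensor A A →ₗ[ℂ] A)))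
    (isClosed_eq (hc.comp (continuous_const_mul _)) ((continuous_const_mul _).comp hc))
    (fun a' b' => ?_) y
  change spatialMul hm (incl A A (a ⊗ₜ b) * incl A A (a' ⊗ₜ b')) =
    spatialMul hm (incl A A (a ⊗ₜ b)) * spatialMul hm (incl A A (a' ⊗ₜ b'))
  rw [incl_tmul_mul, spatialMul_incl_tmul, spatialMul_incl_tmul, spatialMul_incl_tmul,
    mul_assoc, mul_assoc, ← mul_assoc a' b b', hA a' b, mul_assoc]

theorem spatialMul_one (hm : HasSpatiallyContinuousMul A) : spatialMul hm 1 = 1 := by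
  rw [← incl_one_tmul_one, spatialMul_incl_tmul, one_mul]

/-- Slices are multiplicative, so slicing a product amounts to applying `slice ⊗ slice` and then the
multiplication of `B`. The resulting bound `‖spatialMul hB‖` does not depend on the character. -/
theorem HasSpatiallyContinuousMul.spatialTensor (hA : ∀ a a' : A, a * a' = a' * a)
    (hB : HasSpatiallyContinuousMul B) : HasSpatiallyContinuousMul (SpatialTensor A B) := by
  refine AddMonoidHomClass.continuous_of_bound
    (LinearMap.mul' ℂ (SpatialTensor A B) ∘ₗ
      ((AlgTensor.of (SpatialTensor A B) (SpatialTensor A B)).symm :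
        AlgTensor (SpatialTensor A B) (SpatialTensor A B) →ₐ[ℂ]
          SpatialTensor A B ⊗[ℂ] SpatialTensor A B).toLinearMap)
    ‖spatialMul hB‖ fun x => ?_
  change ‖LinearMap.mul' ℂ (SpatialTensor A B) ((AlgTensor.of _ _).symm x)‖ ≤
    ‖spatialMul hB‖ * spatialNorm ((AlgTensor.of _ _).symm x)
  generalize (AlgTensor.of (SpatialTensor A B) (SpatialTensor A B)).symm x = z
  refine norm_le_of_forall_slice hA hB (mul_nonneg (norm_nonneg _) (spatialNorm_nonneg z))
    fun χ => ?_
  have key : slice hB χ (LinearMap.mul' ℂ (SpatialTensor A B) z) =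
      spatialMul hB (map (slice hB χ) (slice hB χ) (incl _ _ z)) := by
    induction z with
    | zero => simp only [map_zero]
    | add x y hx hy => simp only [map_add, hx, hy]
    | tmul a b => rw [map_incl_tmul, spatialMul_incl_tmul, LinearMap.mul'_apply, map_mul]
  rw [key, ← norm_incl]
  exact ((spatialMul hB).le_opNorm _).trans (mul_le_mul_of_nonneg_left
    (NonUnitalStarAlgHom.norm_apply_le _ _) (norm_nonneg _))

/-! ### Naturality of multiplication, flip and leg maps. -/

theorem spatialMul_map (φ : A →⋆ₐ[ℂ] B) (hA : HasSpatiallyContinuousMul A)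
    (hB : HasSpatiallyContinuousMul B) (x : SpatialTensor A A) :
    spatialMul hB (map φ φ x) = φ (spatialMul hA x) :=
  mem_of_forall_tmul (K := LinearMap.eqLocus
      ((spatialMul hB : SpatialTensor B B →ₗ[ℂ] B) ∘ₗ (map φ φ).toAlgHom.toLinearMap)
      (φ.toAlgHom.toLinearMap ∘ₗ (spatialMul hA : SpatialTensor A A →ₗ[ℂ] A)))
    (isClosed_eq ((spatialMul hB).continuous.comp (map φ φ).continuous_of_cstar)
      (φ.continuous_of_cstar.comp (spatialMul hA).continuous))
    (fun a b => by
      change spatialMul hB (map φ φ (incl A A (a ⊗ₜ b))) =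
        φ (spatialMul hA (incl A A (a ⊗ₜ b)))
      rw [map_incl_tmul, spatialMul_incl_tmul, spatialMul_incl_tmul, map_mul]) x

theorem flip_map (φ : A →⋆ₐ[ℂ] B) (x : SpatialTensor A A) :
    SpatialTensor.flip B (map φ φ x) = map φ φ (SpatialTensor.flip A x) :=
  DFunLike.congr_fun (starAlgHom_ext (f := (SpatialTensor.flip B).comp (map φ φ))
    (g := (map φ φ).comp (SpatialTensor.flip A)) fun a b => by
      change SpatialTensor.flip B (map φ φ (incl A A (a ⊗ₜ b))) =
        map φ φ (SpatialTensor.flip A (incl A A (a ⊗ₜ b)))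
      rw [map_incl_tmul, flip_incl_tmul, flip_incl_tmul, map_incl_tmul]) x

theorem legOneThree_map (φ : A →⋆ₐ[ℂ] B) (x : SpatialTensor A A) :
    legOneThree B (map φ φ x) = map (map φ φ) φ (legOneThree A x) :=
  DFunLike.congr_fun (starAlgHom_ext (f := (legOneThree B).comp (map φ φ))
    (g := (map (map φ φ) φ).comp (legOneThree A)) fun a b => by
      change legOneThree B (map φ φ (incl A A (a ⊗ₜ b))) =
        map (map φ φ) φ (legOneThree A (incl A A (a ⊗ₜ b)))
      simp only [legOneThree, map_incl_tmul, inl_apply, map_one, StarAlgHom.coe_id, id_eq]) x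

theorem legOneTwo_map (φ : A →⋆ₐ[ℂ] B) (x : SpatialTensor A A) :
    legOneTwo B (map φ φ x) = map (map φ φ) φ (legOneTwo A x) := by
  simp only [legOneTwo, inl_apply, map_incl_tmul, map_one]

theorem legTwoThree_map (φ : A →⋆ₐ[ℂ] B) (x : SpatialTensor A A) :
    legTwoThree B (map φ φ x) = map (map φ φ) φ (legTwoThree A x) :=
  DFunLike.congr_fun (starAlgHom_ext (f := (legTwoThree B).comp (map φ φ))
    (g := (map (map φ φ) φ).comp (legTwoThree A)) fun a b => by
      change legTwoThree B (map φ φ (incl A A (a ⊗ₜ b))) =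
        map (map φ φ) φ (legTwoThree A (incl A A (a ⊗ₜ b)))
      simp only [legTwoThree, map_incl_tmul, inr_apply, map_one, StarAlgHom.coe_id, id_eq]) x

/-! ### The invertibility axiom for the product. -/

/-- A quantum metric on a commutative algebra vanishes only on the diagonal. -/
theorem IsAlgebraicQuantumMetric.comp_inl_eq_comp_inr {ρ : SpatialTensor A A}
    (h : IsAlgebraicQuantumMetric ρ) (hA : ∀ a a' : A, a * a' = a' * a)
    {ω : SpatialTensor A A →⋆ₐ[ℂ] ℂ} (hω : ω ρ = 0) : ω.comp (inl A A) = ω.comp (inr A A) := by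
  by_contra hne
  obtain ⟨a, ha⟩ := DFunLike.ne_iff.1 hne
  have hm := h.hasSpatiallyContinuousMul
  set d : SpatialTensor A A := inl A A a - inr A A a with hd
  have hz : ω d ≠ 0 := by
    rw [hd, map_sub, sub_ne_zero]
    exact ha
  set q : SpatialTensor A A := 1 - ((ω d)⁻¹ ^ 2) • (d * d) with hq
  have hmd (a : A) : spatialMul hm (inl A A a - inr A A a) = 0 := by
    rw [map_sub, inl_apply, inr_apply, spatialMul_incl_tmul, spatialMul_incl_tmul, mul_one,
      one_mul, sub_self]
  have hmq : spatialMul hm q = 1 := by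
    rw [hq, map_sub, map_smul, spatialMul_mul hA, hd, hmd, mul_zero, smul_zero, sub_zero,
      spatialMul_one]
  have hmq' : spatialMul hm (star q) = 1 := by
    rw [hq, star_sub, star_smul, star_one, star_mul, map_sub, map_smul, spatialMul_mul hA, hd,
      star_sub, ← map_star, ← map_star, hmd, mul_zero, smul_zero, sub_zero, spatialMul_one]
  have hfd : SpatialTensor.flip A d = -d := by
    rw [hd, map_sub, inl_apply, inr_apply, flip_incl_tmul, flip_incl_tmul, neg_sub]
  have hfq : SpatialTensor.flip A q = q := by
    rw [hq, map_sub, map_one, map_smul, map_mul, hfd, neg_mul_neg]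
  have hωq : ω q = 0 := by
    rw [hq, map_sub, map_one, map_smul, map_mul, smul_eq_mul]
    field_simp
    simp
  -- `star q * q` is admissible in the invertibility axiom, yet `ω` kills its sum with `ρ`.
  have hu := h.isUnit_add (star q * q) (star_mul_self_nonneg q)
    (by rw [spatialMul_mul hA, hmq, hmq', one_mul]) (by rw [map_mul, map_star, hfq])
  have := hu.map ω
  rw [map_add, map_mul, hω, hωq, mul_zero, add_zero] at this
  exact not_isUnit_zero this

open scoped ComplexOrder in
theorem IsAlgebraicQuantumMetric.isUnit_productMetric_add {ρ₁ : SpatialTensor A A}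
    {ρ₂ : SpatialTensor B B} (h₁ : IsAlgebraicQuantumMetric ρ₁) (h₂ : IsAlgebraicQuantumMetric ρ₂)
    (hA : ∀ a a' : A, a * a' = a' * a) (hm : HasSpatiallyContinuousMul (SpatialTensor A B))
    {ν : SpatialTensor (SpatialTensor A B) (SpatialTensor A B)} (hν : 0 ≤ ν)
    (hmν : spatialMul hm ν = 1) (hfν : SpatialTensor.flip _ ν = ν) :
    IsUnit (productMetric ρ₁ ρ₂ + ν) := by
  have hB := h₂.hasSpatiallyContinuousMul
  refine isUnit_of_forall_doubleSlice hA hB ?_ fun ω => ?_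
  · exact (((IsSelfAdjoint.of_nonneg h₁.nonneg).map _).add
      ((IsSelfAdjoint.of_nonneg h₂.nonneg).map _)).add (.of_nonneg hν)
  rw [productMetric, map_add, map_add, doubleSlice_map_inl, doubleSlice_map_inr]
  have hν' : 0 ≤ doubleSlice hB ω ν := map_nonneg _ hν
  have hω : 0 ≤ ω ρ₁ := map_nonneg ω h₁.nonneg
  rcases hω.eq_or_lt with h0 | hpos
  -- On the diagonal both slices agree, so the fibre of `ν` is a valid test element for `ρ₂`.
  · rw [← h0, zero_smul, zero_add]
    have he := h₁.comp_inl_eq_comp_inr hA h0.symm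
    have hs : doubleSlice hB ω =
        map (slice hB (ω.comp (inl A A))) (slice hB (ω.comp (inl A A))) := by
      rw [doubleSlice, ← he]
    refine h₂.isUnit_add _ hν' ?_ ?_
    · rw [hs, spatialMul_map _ hm, hmν, map_one]
    · rw [hs, flip_map, hfν]
  -- Off the zero set of `ρ₁`, the scalar `ω ρ₁` alone bounds the fibre below.
  · have hpos' : 0 < (ω ρ₁).re := (Complex.lt_def.1 hpos).1
    have hre : ω ρ₁ = ((ω ρ₁).re : ℂ) := (Complex.eq_re_of_ofReal_le (r := 0) (by simpa using hω))
    refine CStarAlgebra.isUnit_of_le (algebraMap ℝ (SpatialTensor B B) (ω ρ₁).re) ?_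
      (isStrictlyPositive_algebraMap hpos')
    rw [add_assoc, hre, Complex.coe_smul, Complex.ofReal_re, ← Algebra.algebraMap_eq_smul_one]
    exact le_add_of_nonneg_right (add_nonneg h₂.nonneg hν')

/-! ### All axioms for the product metric. -/

theorem IsAlgebraicQuantumMetric.productMetric {ρ₁ : SpatialTensor A A}
    {ρ₂ : SpatialTensor B B} (h₁ : IsAlgebraicQuantumMetric ρ₁) (h₂ : IsAlgebraicQuantumMetric ρ₂)
    (hA : ∀ a a' : A, a * a' = a' * a) : IsAlgebraicQuantumMetric (productMetric ρ₁ ρ₂) where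
  hasSpatiallyContinuousMul := h₂.hasSpatiallyContinuousMul.spatialTensor hA
  nonneg := add_nonneg (map_nonneg _ h₁.nonneg) (map_nonneg _ h₂.nonneg)
  mul_eq_zero := by
    rw [_root_.productMetric, map_add, spatialMul_map _ h₁.hasSpatiallyContinuousMul,
      spatialMul_map _ h₂.hasSpatiallyContinuousMul, h₁.mul_eq_zero, h₂.mul_eq_zero, map_zero,
      map_zero, add_zero]
  isUnit_add _ hν hmν hfν := h₁.isUnit_productMetric_add h₂ hA _ hν hmν hfν
  flip_eq := by
    rw [_root_.productMetric, map_add, flip_map, flip_map, h₁.flip_eq, h₂.flip_eq]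
  triangle := by
    -- The leg terms are regrouped by factor, so that the inequality is a sum of images of the two
    -- triangle inequalities under positive maps.
    rw [_root_.productMetric, map_add, map_add, map_add, legOneThree_map, legOneThree_map,
      legOneTwo_map, legOneTwo_map, legTwoThree_map, legTwoThree_map, add_add_add_comm,
      ← map_add, ← map_add]
    exact add_le_add (OrderHomClass.mono _ h₁.triangle) (OrderHomClass.mono _ h₂.triangle)

end Product

theorem theorem7 {A₁ A₂ : Type u} [CommCStarAlgebra A₁] [CStarAlgebra A₂]
    (ρ₁ : SpatialTensor A₁ A₁) (ρ₂ : SpatialTensor A₂ A₂)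
    (h₁ : IsAlgebraicQuantumMetric ρ₁) (h₂ : IsAlgebraicQuantumMetric ρ₂) :
    IsAlgebraicQuantumMetric (productMetric ρ₁ ρ₂) :=
  h₁.productMetric h₂ mul_comm
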